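/- Let $L$ be a non-discrete locally compact (Hausdorff) topological field of characteristic zero, let $n\ge 0$, and let $dg$ be a Haar measure on $GL_n(L)$. A \emph{second degree character} on $L^n$ is a continuous function $f:L^n\to\mathbb{T}=\{z\in\mathbb{C}:|z|=1\}$ such that $(x,y)\mapsto f(x+y)f(x)^{-1}f(y)^{-1}$ is a group character as a function of $x$ and as a function of $y$. It is \emph{non-degenerate} if the morphism $\varrho$ from $L^n$ to its Pontryagin dual $(L^n)^*$ given by $\langle\varrho(y),x\rangle=f(x+y)f(x)^{-1}f(y)^{-1}$ is an isomorphism of topological groups. $C_c^\infty(GL_n(L))$ denotes the space of compactly supported functions $GL_n(L)\to\mathbb{C}$ that are $C^\infty$ (as functions on an open subset of the real vector space $M_n(L)$) if $L$ is isomorphic to $\mathbb{R}$ or $\mathbb{C}$, and locally constant if $L$ is non-archimedean. A \emph{Schwartz(-Bruhat) function} on $L^n$ is a Schwartz function on the real vector space $L^n$ in the first case, and a locally constant function $L^n\to\mathbb{C}$ with compact support in the second. \textbf{Theorem.} Let $f$ be a non-degenerate second degree character on $L^n$ and let $\phi\in C_c^\infty(GL_n(L))$. Then for every $v\in L^n$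 the integral $$\lambda(\phi)f(v)=\int_{GL_n(L)}\phi(g)\,f(g^{-1}v)\,dg$$ converges absolutely, and $\lambda(\phi)f$ is a Schwartz(-Bruhat) function on $L^n$. -/

import Mathlib

open scoped ContDiff

noncomputable section

namespace SecondDegree

section Characters

variable {V : Type*} [AddCommGroup V] [TopologicalSpace V]

/-- The function `(x, y) ↦ f (x + y) f(x)⁻¹ f(y)⁻¹` attached to `f : V → 𝕋`. -/
def polar (f : V → Circle) (x y : V) : Circle :=
  f (x + y) * (f x)⁻¹ * (f y)⁻¹

/-- Second degree characters of a topological abelian group `V`: the continuous functions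
`f : V → 𝕋` such that `f (x + y) f(x)⁻¹ f(y)⁻¹` is a character in `x` and a character in `y`
(the continuity of these characters follows from that of `f`). -/
structure IsSecondDegreeCharacter (f : V → Circle) : Prop where
  continuous : Continuous f
  polar_add_left : ∀ x x' y, polar f (x + x') y = polar f x y * polar f x' y
  polar_add_right : ∀ x y y', polar f x (y + y') = polar f x y * polar f x y'

/-- `f` is non-degenerate if the morphism `ϱ` from `V` to its Pontryagin dual defined by
`⟨ϱ y, x⟩ = f (x + y) f(x)⁻¹ f(y)⁻¹` is an isomorphism of topological groups.
(Mathlib's Pontryagin dual is written for multiplicative groups.) -/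
def IsNondegenerate (f : V → Circle) : Prop :=
  ∃ ϱ : Multiplicative V ≃ₜ* PontryaginDual (Multiplicative V),
    ∀ x y : V, ϱ (Multiplicative.ofAdd y) (Multiplicative.ofAdd x) = polar f x y

/-- Schwartz(-Bruhat) functions on a finite dimensional vector space `V` over a locally compact
field. If the field is real or complex then `V` is, as a topological group, isomorphic to some
`ℝ^m`, and the functions are the usual Schwartz functions in such a linear coordinate system
(two such systems differ by an element of `GL_m(ℝ)`, since a continuous additive map between
real vector spaces is linear). If the field is non-archimedean then `V` is totally disconnected
and they are the locally constant functions with compact support. -/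
def IsSchwartzBruhat (F : V → ℂ) : Prop :=
  (∃ (m : ℕ) (e : EuclideanSpace ℝ (Fin m) ≃ₜ+ V)
      (g : SchwartzMap (EuclideanSpace ℝ (Fin m)) ℂ), ∀ x, F (e x) = g x) ∨
    (TotallyDisconnectedSpace V ∧ IsLocallyConstant F ∧ HasCompactSupport F)

end Characters

section GeneralLinear

variable {L : Type*} [Field L] [TopologicalSpace L] {n : ℕ}

/-- Smooth functions on `GL_n(L)`, `L` a locally compact field. If `L` is real or complex, these
are the functions that are `C^∞` on the open subset `GL_n(L)` of the real vector space `M_n(L)`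
(in real linear coordinates on `M_n(L)`; outside `GL_n(L)` the function is given the irrelevant
value `0`). If `L` is non-archimedean, these are the locally constant functions. -/
def IsSmoothGL (φ : GL (Fin n) L → ℂ) : Prop :=
  (∃ (m : ℕ) (e : EuclideanSpace ℝ (Fin m) ≃ₜ+ Matrix (Fin n) (Fin n) L),
      ContDiffOn ℝ ∞
        (fun x => Function.extend (Units.val : GL (Fin n) L → Matrix (Fin n) (Fin n) L) φ 0 (e x))
        {x | IsUnit (e x)}) ∨
    (TotallyDisconnectedSpace L ∧ IsLocallyConstant φ)

/-- The space `C_c^∞(GL_n(L))`. -/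
def IsTestFunctionGL (φ : GL (Fin n) L → ℂ) : Prop :=
  IsSmoothGL φ ∧ HasCompactSupport φ

/-- The integrand `g ↦ φ(g) f(g⁻¹ v)`. -/
def integrand (φ : GL (Fin n) L → ℂ) (f : (Fin n → L) → Circle) (v : Fin n → L)
    (g : GL (Fin n) L) : ℂ :=
  φ g * (f (((g⁻¹ : GL (Fin n) L) : Matrix (Fin n) (Fin n) L).mulVec v) : ℂ)

/-- `λ(φ)f(v) = ∫ φ(g) f(g⁻¹ v) dg`, the integral being over `GL_n(L)` with respect to `μ`. -/
def lam [MeasurableSpace (GL (Fin n) L)] (μ : MeasureTheory.Measure (GL (Fin n) L))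
    (φ : GL (Fin n) L → ℂ) (f : (Fin n → L) → Circle) (v : Fin n → L) : ℂ :=
  ∫ g, integrand φ f v g ∂μ

end GeneralLinear

end SecondDegree

end

/-!
Haar measure on `GL_n(L)` is additive Haar measure on `M_n(L)` divided by the factor by which left
multiplication scales it (`exists_integral_units_eq`). Hence, after the substitution `X = (g⁻¹)ᵀ`,
`λ(φ)f(v)` is up to a constant the oscillatory integral `∫ ψ(X) f(Xᵀ v) dX` over the vector space
`M_n(L)`, where the amplitude `ψ` has compact support contained in the set of invertible matrices
and is as regular as `φ` (`exists_lam_eq`). For `v ≠ 0` the map `X ↦ Xᵀ v` is onto, and on the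
support of `ψ` the vector `Xᵀ v` is not zero; as `f` is non-degenerate, the phase is not stationary
there, and the oscillation forces decay as `v` grows.

If `L` is real or complex then `f` lifts to `f = exp (i q)` for a real polynomial `q` of degree two
whose quadratic part is given by a non-degenerate bilinear form `B`
(`IsSecondDegreeCharacter.exists_isGaussian`). Since `X ↦ Xᵀ v` is onto with an inverse of size
`1 / ‖v‖`, integration by parts bounds the moments of the integral against `B (Xᵀ v) z` for fixed vectors
`z` (`norm_moment_le`). These vectors give all linear forms in `Xᵀ v`, and `v` is recovered from
`Xᵀ v` on the support of `ψ`, so that each integration by parts gains a power of `‖v‖`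
(`exists_norm_pow_mul_osc_le`). The derivatives of the integral with respect to `v` are integrals of
the same kind, with polynomial factors in `v`, so that the integral is a Schwartz function of `v`
(`exists_schwartzMap_eq_osc`).

If `L` is non-archimedean then `L` is totally disconnected, and both `f` and `ψ` are locally
constant. For large `v`, the translations of `X` by a small compact open group of matrices `Y` do
not change `ψ(X)`, satisfy `f(Yᵀ v) = 1`, and therefore multiply `ψ(X) f(Xᵀ v)` by the character
`⟨Xᵀ v, Yᵀ v⟩` of `Y`, which is nontrivial. So the integral vanishes
(`integral_eq_zero_of_character`). That such groups exist comes from a scaling argument: a suitable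
integer `N` is topologically nilpotent, `v = N⁻ʳ u` with `u` in a compact set of nonzero vectors
(`exists_compact_fundamental_domain`), and one takes `Y = N²ʳ Z`, where `⟨Xᵀ u, Zᵀ u⟩ ≠ 1`.
-/

noncomputable section

set_option linter.unusedSectionVars false

namespace SecondDegree

open MeasureTheory Filter Topology Module
open scoped NNReal ENNReal

/-! ### Oscillatory integrals with a non-degenerate quadratic phase -/

section Oscillatory

-- The types live in one universe because the values of amplitudes change from `E` to spaces such as
-- `W →L[ℝ] E` and `V →L[ℝ] E` in the inductions below.
variable {V W : Type} [NormedAddCommGroup V] [NormedSpace ℝ V]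
  [NormedAddCommGroup W] [NormedSpace ℝ W] [MeasurableSpace W]
  {E : Type} [NormedAddCommGroup E] [NormedSpace ℝ E] [NormedSpace ℂ E] [IsScalarTower ℝ ℂ E]

/-- `F` is a unimodular function with logarithmic derivative `i (B x + l)` at `x`, such as
`exp (i (B x x / 2 + l x))` for a symmetric bilinear form `B` and a linear form `l`. -/
structure IsGaussian (F : V → ℂ) (B : V →L[ℝ] V →L[ℝ] ℝ) (l : V →L[ℝ] ℝ) : Prop where
  norm_eq_one : ∀ x, ‖F x‖ = 1
  hasFDerivAt : ∀ x, HasFDerivAt F ((Complex.I * F x) • Complex.ofRealCLM.comp (B x + l)) x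

/-- Amplitudes for the family of operators `ρ`: smooth functions whose support is compact and
consists of parameters `x` with `ρ x` invertible. -/
structure IsAmplitude (ρ : W →L[ℝ] V →L[ℝ] V) (ψ : W → E) : Prop where
  contDiff : ContDiff ℝ ∞ ψ
  hasCompactSupport : HasCompactSupport ψ
  tsupport_subset : tsupport ψ ⊆ {x | IsUnit (ρ x)}

/-- The oscillatory integral `∫ F (ρ x v) ψ x dx`, as a function of `v`. -/
def osc (ν : Measure W) (ρ : W →L[ℝ] V →L[ℝ] V) (F : V → ℂ) (ψ : W → E) (v : V) : E :=
  ∫ x, F (ρ x v) • ψ x ∂ν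

variable {ρ : W →L[ℝ] V →L[ℝ] V} {F : V → ℂ} {B : V →L[ℝ] V →L[ℝ] ℝ} {l : V →L[ℝ] ℝ} {ψ : W → E}

lemma IsGaussian.continuous (hF : IsGaussian F B l) : Continuous F :=
  continuous_iff_continuousAt.2 fun x => (hF.hasFDerivAt x).continuousAt

lemma IsAmplitude.fderiv (hψ : IsAmplitude ρ ψ) : IsAmplitude ρ (fderiv ℝ ψ) where
  contDiff := hψ.contDiff.fderiv_right (m := ∞) (by simp)
  hasCompactSupport := hψ.hasCompactSupport.fderiv ℝ
  tsupport_subset := (tsupport_fderiv_subset ℝ).trans hψ.tsupport_subset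

lemma contDiff_of_contDiffOn_of_tsupport_subset {E' : Type} [NormedAddCommGroup E']
    [NormedSpace ℝ E'] {s : Set W} (hs : IsOpen s) {ψ : W → E'} (hψ : ContDiffOn ℝ ∞ ψ s)
    (hsub : tsupport ψ ⊆ s) : ContDiff ℝ ∞ ψ := by
  refine contDiff_iff_contDiffAt.2 fun x => ?_
  by_cases hx : x ∈ tsupport ψ
  · exact (hψ x (hsub hx)).contDiffAt (hs.mem_nhds (hsub hx))
  · exact contDiffAt_const.congr_of_eventuallyEq (notMem_tsupport_iff_eventuallyEq.1 hx)

/-- Amplitudes may be modified by any function that is smooth where `ρ` is invertible. -/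
lemma IsAmplitude.of_contDiffOn {E' : Type} [NormedAddCommGroup E'] [NormedSpace ℝ E']
    [CompleteSpace V]
    (hψ : IsAmplitude ρ ψ) {ψ' : W → E'} (hs : ContDiffOn ℝ ∞ ψ' {x | IsUnit (ρ x)})
    (h0 : ∀ x, ψ x = 0 → ψ' x = 0) : IsAmplitude ρ ψ' := by
  have hsub : tsupport ψ' ⊆ tsupport ψ := closure_mono fun x hx h => hx (h0 x h)
  have hopen : IsOpen {x : W | IsUnit (ρ x)} := Units.isOpen.preimage ρ.continuous
  exact ⟨contDiff_of_contDiffOn_of_tsupport_subset hopen hs (hsub.trans hψ.tsupport_subset),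
    hψ.hasCompactSupport.mono' (subset_closure.trans hsub), hsub.trans hψ.tsupport_subset⟩

lemma integrable_mul_smul [BorelSpace W] [FiniteDimensional ℝ W] {ν : Measure W}
    [IsFiniteMeasureOnCompacts ν] (hψ : IsAmplitude ρ ψ)
    {G : W → ℂ} (hG : Continuous G) : Integrable (fun x => G x • ψ x) ν :=
  (hG.smul hψ.contDiff.continuous).integrable_of_hasCompactSupport hψ.hasCompactSupport.smul_left

lemma IsGaussian.hasFDerivAt_comp (hF : IsGaussian F B l) (x : W) (v : V) :
    HasFDerivAt (fun x => F (ρ x v))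
      ((Complex.I * F (ρ x v)) • Complex.ofRealCLM.comp ((B (ρ x v) + l).comp (ρ.flip v))) x :=
  HasFDerivAt.comp (g := F) (f := ρ.flip v) x (hF.hasFDerivAt (ρ x v)) (ρ.flip v).hasFDerivAt

/-- Integration by parts in the direction `h` with `ρ h v = z`: the moment of the oscillatory
integral against `B (ρ x v) z` is controlled by oscillatory integrals without the moment. -/
lemma norm_moment_le [BorelSpace W] [FiniteDimensional ℝ W] {ν : Measure W} [ν.IsAddHaarMeasure]
    (hF : IsGaussian F B l) (hψ : IsAmplitude ρ ψ) {v z : V} {h : W} (hz : ρ h v = z) :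
    ‖∫ x, (F (ρ x v) * (B (ρ x v) z : ℂ)) • ψ x ∂ν‖ ≤
      ‖osc ν ρ F (fderiv ℝ ψ) v‖ * ‖h‖ + ‖l z‖ * ‖osc ν ρ F ψ v‖ := by
  have hFc : Continuous fun x => F (ρ x v) := hF.continuous.comp (ρ.flip v).continuous
  have hBc : Continuous fun x => ((B (ρ x v) z : ℝ) : ℂ) :=
    Complex.continuous_ofReal.comp ((B.flip z).continuous.comp (ρ.flip v).continuous)
  have hd := integrable_mul_smul (ν := ν) hψ.fderiv hFc
  have hparts := integral_bilinear_hasLineDerivAt_right_eq_neg_left_of_integrable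
    (μ := ν) (f := fun x => F (ρ x v)) (g := ψ) (v := h)
    (f' := fun x => Complex.I * F (ρ x v) * ((B (ρ x v) z + l z : ℝ) : ℂ))
    (g' := fun x => fderiv ℝ ψ x h) (B := ContinuousLinearMap.lsmul ℝ ℂ)
    (integrable_mul_smul hψ (by
      push_cast
      exact (continuous_const.mul hFc).mul (hBc.add continuous_const)))
    (hd.apply_continuousLinearMap h) (integrable_mul_smul hψ hFc)
    (fun x _ => by simpa [hz, mul_add] using (hF.hasFDerivAt_comp (ρ := ρ) x v).hasLineDerivAt h)
    (fun x _ => ((hψ.contDiff.differentiable (by simp)) x).hasFDerivAt.hasLineDerivAt h)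
  have h1 : osc ν ρ F (fderiv ℝ ψ) v h = ∫ x, F (ρ x v) • fderiv ℝ ψ x h ∂ν := by
    rw [osc, ContinuousLinearMap.integral_apply hd]; rfl
  have h2 : ∫ x, (Complex.I * F (ρ x v) * ((B (ρ x v) z + l z : ℝ) : ℂ)) • ψ x ∂ν =
      Complex.I • (∫ x, (F (ρ x v) * (B (ρ x v) z : ℂ)) • ψ x ∂ν) +
        (Complex.I * (l z : ℂ)) • osc ν ρ F ψ v := by
    rw [osc, ← integral_smul, ← integral_smul, ← integral_add]
    · congr 1 with x
      rw [smul_smul, smul_smul, ← add_smul]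
      congr 1
      push_cast
      ring
    · exact (integrable_mul_smul hψ (hFc.mul hBc)).smul _
    · exact (integrable_mul_smul hψ hFc).smul _
  simp only [ContinuousLinearMap.lsmul_apply] at hparts
  rw [← h1, h2] at hparts
  have h3 : Complex.I • (∫ x, (F (ρ x v) * (B (ρ x v) z : ℂ)) • ψ x ∂ν) =
      -osc ν ρ F (fderiv ℝ ψ) v h - (Complex.I * (l z : ℂ)) • osc ν ρ F ψ v := by
    rw [hparts]; abel
  calc _ = ‖Complex.I • (∫ x, (F (ρ x v) * (B (ρ x v) z : ℂ)) • ψ x ∂ν)‖ := by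
        rw [norm_smul]; simp
    _ ≤ ‖osc ν ρ F (fderiv ℝ ψ) v h‖ + ‖(Complex.I * (l z : ℂ)) • osc ν ρ F ψ v‖ := by
        rw [h3]; exact (norm_sub_le _ _).trans (by rw [norm_neg])
    _ ≤ _ := by
        gcongr
        · exact ContinuousLinearMap.le_opNorm _ _
        · rw [norm_smul]; simp

lemma norm_osc_le (hF : IsGaussian F B l) (ν : Measure W) (ψ : W → E) (v : V) :
    ‖osc ν ρ F ψ v‖ ≤ ∫ x, ‖ψ x‖ ∂ν :=
  (norm_integral_le_integral_norm _).trans_eq (by simp [norm_smul, hF.norm_eq_one])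

/-- If every `ρ · v` with `v ≠ 0` is onto, then solutions `h` of `ρ h v = z` can be chosen bounded
uniformly in `‖v‖ ≥ 1`: by homogeneity and compactness this is a local question on the sphere. -/
lemma exists_bounded_lift [FiniteDimensional ℝ V]
    (hρ : ∀ v ≠ 0, Function.Surjective fun h => ρ h v) :
    ∃ C : ℝ, 0 ≤ C ∧ ∀ v : V, 1 ≤ ‖v‖ → ∀ z, ∃ h, ρ h v = z ∧ ‖h‖ ≤ C * ‖z‖ := by
  suffices hs : ∃ C : ℝ, 0 ≤ C ∧ ∀ v ∈ Metric.sphere (0 : V) 1, ∀ z, ∃ h, ρ h v = z ∧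
      ‖h‖ ≤ C * ‖z‖ by
    obtain ⟨C, hC, H⟩ := hs
    refine ⟨C, hC, fun v hv z => ?_⟩
    have hv0 : 0 < ‖v‖ := by linarith
    obtain ⟨h, h1, h2⟩ := H (‖v‖⁻¹ • v) (by simp [norm_smul, hv0.ne']) z
    refine ⟨‖v‖⁻¹ • h, by simpa using h1, ?_⟩
    rw [norm_smul, norm_inv, norm_norm]
    exact (mul_le_of_le_one_left (norm_nonneg _) (inv_le_one_of_one_le₀ hv)).trans h2
  refine (isCompact_sphere (0 : V) 1).induction_on
    (p := fun s => ∃ C : ℝ, 0 ≤ C ∧ ∀ v ∈ s, ∀ z, ∃ h, ρ h v = z ∧ ‖h‖ ≤ C * ‖z‖) ?_ ?_ ?_ ?_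
  · exact ⟨0, le_rfl, by simp⟩
  · rintro s t hst ⟨C, hC, H⟩
    exact ⟨C, hC, fun v hv => H v (hst hv)⟩
  · rintro s t ⟨C, hC, H⟩ ⟨C', hC', H'⟩
    refine ⟨max C C', le_max_of_le_left hC, ?_⟩
    rintro v (hv | hv) z
    · obtain ⟨h, h1, h2⟩ := H v hv z
      exact ⟨h, h1, h2.trans (by gcongr; exact le_max_left _ _)⟩
    · obtain ⟨h, h1, h2⟩ := H' v hv z
      exact ⟨h, h1, h2.trans (by gcongr; exact le_max_right _ _)⟩
  · intro v₀ hv₀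
    have hne : v₀ ≠ 0 := by rintro rfl; simp at hv₀
    obtain ⟨R', hR'⟩ := (ρ.flip v₀ : W →ₗ[ℝ] V).exists_rightInverse_of_surjective
      (LinearMap.range_eq_top.2 (hρ v₀ hne))
    -- A linear section at `v₀` stays a section at nearby `v` after correction by `(T v)⁻¹`.
    let R : V →L[ℝ] W := LinearMap.toContinuousLinearMap R'
    let T : V → V →L[ℝ] V := fun v => (ρ.flip v).comp R
    have hTc : Continuous T := ρ.flip.continuous.clm_comp continuous_const
    have hT1 : T v₀ = ((1 : (V →L[ℝ] V)ˣ) : V →L[ℝ] V) := by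
      ext z; exact LinearMap.congr_fun hR' z
    have hinv : ContinuousAt (fun v => Ring.inverse (T v)) v₀ := by
      refine ContinuousAt.comp (g := Ring.inverse) ?_ hTc.continuousAt
      rw [hT1]; exact NormedRing.inverse_continuousAt _
    have hu : ∀ᶠ v in 𝓝 v₀, IsUnit (T v) :=
      hTc.continuousAt (Units.isOpen.mem_nhds (by rw [hT1]; exact Units.isUnit _))
    have hb : ∀ᶠ v in 𝓝 v₀, ‖Ring.inverse (T v)‖ < ‖Ring.inverse (T v₀)‖ + 1 :=
      hinv.norm.eventually_lt_const (by simp)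
    refine ⟨{v | IsUnit (T v) ∧ ‖Ring.inverse (T v)‖ < ‖Ring.inverse (T v₀)‖ + 1},
      mem_nhdsWithin_of_mem_nhds (hu.and hb),
      ‖R‖ * (‖Ring.inverse (T v₀)‖ + 1), by positivity, ?_⟩
    rintro v ⟨hv1, hv2⟩ z
    refine ⟨R (Ring.inverse (T v) z), ?_, ?_⟩
    · have := Ring.mul_inverse_cancel _ hv1
      exact congr($this z)
    · calc _ ≤ ‖R‖ * (‖Ring.inverse (T v)‖ * ‖z‖) :=
            (R.le_opNorm _).trans (by gcongr; exact ContinuousLinearMap.le_opNorm _ _)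
        _ ≤ ‖R‖ * ((‖Ring.inverse (T v₀)‖ + 1) * ‖z‖) := by gcongr
        _ = _ := by ring

end Oscillatory

section OscillatorySchwartz

variable {V W : Type} [NormedAddCommGroup V] [NormedSpace ℝ V]
  [NormedAddCommGroup W] [NormedSpace ℝ W] [MeasurableSpace W]
  {E : Type} [NormedAddCommGroup E] [NormedSpace ℝ E] [NormedSpace ℂ E] [IsScalarTower ℝ ℂ E]
  {ρ : W →L[ℝ] V →L[ℝ] V} {F : V → ℂ} {B : V →L[ℝ] V →L[ℝ] ℝ} {l : V →L[ℝ] ℝ} {ψ : W → E}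

lemma ofReal_smul_eq (r : ℝ) (y : E) : (r : ℂ) • y = r • y :=
  algebraMap_smul ℂ r y

/-- If `B` is non-degenerate then every linear form is of the form `B · z`. -/
lemma exists_dual_vectors [FiniteDimensional ℝ V] (hB : ∀ z, (∀ x, B x z = 0) → z = 0)
    (m : V →L[ℝ] ℝ) : ∃ z, ∀ x, B x z = m x := by
  let T : V →ₗ[ℝ] Module.Dual ℝ V :=
    { toFun := fun z => (B.flip z : V →ₗ[ℝ] ℝ)
      map_add' := fun x y => by ext; simp
      map_smul' := fun c x => by ext; simp }
  have hT : Function.Injective T := by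
    rw [← LinearMap.ker_eq_bot, LinearMap.ker_eq_bot']
    exact fun z hz => hB z fun x => LinearMap.congr_fun hz x
  have hs : Function.Surjective T :=
    (LinearMap.injective_iff_surjective_of_finrank_eq_finrank
      (Subspace.dual_finrank_eq (K := ℝ) (V := V)).symm).1 hT
  obtain ⟨z, hz⟩ := hs (m : V →ₗ[ℝ] ℝ)
  exact ⟨z, fun x => LinearMap.congr_fun hz x⟩

/-- Rapid decay. Writing `v = (ρ x)⁻¹ (ρ x v)` and expanding `ρ x v` in a basis, each coordinate
of `v` times the oscillatory integral is a sum of moments, which integration by parts bounds by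
oscillatory integrals; this gains one power of `‖v‖`. -/
lemma exists_norm_pow_mul_osc_le [BorelSpace W] [FiniteDimensional ℝ W] [FiniteDimensional ℝ V]
    (ν : Measure W) [ν.IsAddHaarMeasure] (hF : IsGaussian F B l)
    (hB : ∀ z, (∀ x, B x z = 0) → z = 0)
    (hρ : ∀ v ≠ 0, Function.Surjective fun h => ρ h v) (N : ℕ) :
    ∀ {E : Type} [NormedAddCommGroup E] [NormedSpace ℝ E] [NormedSpace ℂ E] [IsScalarTower ℝ ℂ E]
      {ψ : W → E}, IsAmplitude ρ ψ → ∃ C, ∀ v, ‖v‖ ^ N * ‖osc ν ρ F ψ v‖ ≤ C := by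
  induction N with
  | zero => exact fun {E} _ _ _ _ ψ hψ => ⟨_, fun v => by simpa using norm_osc_le hF ν ψ v⟩
  | succ N ih =>
    intro E _ _ _ _ ψ hψ
    obtain ⟨K, hK0, hK⟩ := exists_bounded_lift hρ
    let b := Module.finBasis ℝ V
    let m : Fin (finrank ℝ V) → V →L[ℝ] ℝ := fun k => LinearMap.toContinuousLinearMap (b.coord k)
    choose z hz using fun k => exists_dual_vectors hB (m k)
    let ψ' : Fin (finrank ℝ V) → Fin (finrank ℝ V) → W → E :=
      fun j k x => (m j (Ring.inverse (ρ x) (b k)) : ℝ) • ψ x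
    have hψ' : ∀ j k, IsAmplitude ρ (ψ' j k) := by
      intro j k
      refine hψ.of_contDiffOn (fun x hx => ?_) fun x hx => by simp [ψ', hx]
      obtain ⟨u, hu⟩ := hx
      have h1 : ContDiffAt ℝ ∞ (fun x => Ring.inverse (ρ x)) x :=
        ContDiffAt.comp (g := Ring.inverse) x (by rw [← hu]; exact contDiffAt_ringInverse ℝ u)
          ρ.contDiff.contDiffAt
      exact (((m j).contDiff.contDiffAt.comp x (h1.clm_apply contDiffAt_const)).smul
        hψ.contDiff.contDiffAt).contDiffWithinAt
    choose C₁ hC₁ using fun j k => ih (hψ' j k)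
    choose C₂ hC₂ using fun j k => ih (hψ' j k).fderiv
    have hcoord : ∀ j v, 1 ≤ ‖v‖ → ‖v‖ ^ N * (‖m j v‖ * ‖osc ν ρ F ψ v‖) ≤
        ∑ k, (C₂ j k * (K * ‖z k‖) + ‖l (z k)‖ * C₁ j k) := by
      intro j v hv
      have hFc : Continuous fun x => F (ρ x v) := hF.continuous.comp (ρ.flip v).continuous
      have key : (m j v : ℂ) • osc ν ρ F ψ v =
          ∑ k, ∫ x, (F (ρ x v) * (B (ρ x v) (z k) : ℂ)) • ψ' j k x ∂ν := by
        rw [← integral_finsetSum, osc, ← integral_smul]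
        · congr 1 with x
          by_cases hx : ψ x = 0
          · simp [hx, ψ']
          have hu : IsUnit (ρ x) := hψ.tsupport_subset (subset_tsupport _ hx)
          have hv : m j v = ∑ k, m k (ρ x v) * m j (Ring.inverse (ρ x) (b k)) := by
            have h1 : Ring.inverse (ρ x) (ρ x v) = v := congr($(Ring.inverse_mul_cancel _ hu) v)
            have h2 := congr(m j (Ring.inverse (ρ x) $(b.sum_repr (ρ x v))))
            rw [h1] at h2
            rw [← h2]
            simp only [map_sum, map_smul, smul_eq_mul]
            rfl
          have hterm : ∀ k, (F (ρ x v) * (B (ρ x v) (z k) : ℂ)) • ψ' j k x =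
              (F (ρ x v) * ((m k (ρ x v) * m j (Ring.inverse (ρ x) (b k)) : ℝ) : ℂ)) • ψ x := by
            intro k
            simp only [ψ', hz]
            rw [← ofReal_smul_eq (m j (Ring.inverse (ρ x) (b k))), smul_smul]
            congr 1
            push_cast
            ring
          rw [Finset.sum_congr rfl fun k _ => hterm k, ← Finset.sum_smul, ← Finset.mul_sum,
            ← Complex.ofReal_sum, ← hv, smul_smul, mul_comm]
        · intro k _
          exact integrable_mul_smul (hψ' j k) (hFc.mul (Complex.continuous_ofReal.comp
            ((B.flip (z k)).continuous.comp (ρ.flip v).continuous)))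
      have hn : ‖m j v‖ * ‖osc ν ρ F ψ v‖ = ‖(m j v : ℂ) • osc ν ρ F ψ v‖ := by
        rw [norm_smul]; simp
      rw [hn, key]
      calc _ ≤ ‖v‖ ^ N * ∑ k, ‖∫ x, (F (ρ x v) * (B (ρ x v) (z k) : ℂ)) • ψ' j k x ∂ν‖ := by
            gcongr; exact norm_sum_le _ _
        _ = ∑ k, ‖v‖ ^ N * ‖∫ x, (F (ρ x v) * (B (ρ x v) (z k) : ℂ)) • ψ' j k x ∂ν‖ := by
            rw [Finset.mul_sum]
        _ ≤ _ := by
            refine Finset.sum_le_sum fun k _ => ?_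
            obtain ⟨h, hh, hle⟩ := hK v hv (z k)
            calc _ ≤ ‖v‖ ^ N * (‖osc ν ρ F (fderiv ℝ (ψ' j k)) v‖ * (K * ‖z k‖) +
                    ‖l (z k)‖ * ‖osc ν ρ F (ψ' j k) v‖) := by
                  gcongr
                  exact (norm_moment_le hF (hψ' j k) hh).trans (by gcongr)
              _ = (‖v‖ ^ N * ‖osc ν ρ F (fderiv ℝ (ψ' j k)) v‖) * (K * ‖z k‖) +
                    ‖l (z k)‖ * (‖v‖ ^ N * ‖osc ν ρ F (ψ' j k) v‖) := by ring
              _ ≤ _ := by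
                  gcongr
                  · exact hC₂ j k v
                  · exact hC₁ j k v
    refine ⟨max (∫ x, ‖ψ x‖ ∂ν)
      (∑ j, (∑ k, (C₂ j k * (K * ‖z k‖) + ‖l (z k)‖ * C₁ j k)) * ‖b j‖), fun v => ?_⟩
    rcases le_total ‖v‖ 1 with hv | hv
    · refine le_max_of_le_left ?_
      exact (mul_le_of_le_one_left (norm_nonneg _) (pow_le_one₀ (norm_nonneg _) hv)).trans
        (norm_osc_le hF ν ψ v)
    · refine le_max_of_le_right ?_
      have hvle : ‖v‖ ≤ ∑ j, ‖m j v‖ * ‖b j‖ := by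
        conv_lhs => rw [← b.sum_repr v]
        exact (norm_sum_le _ _).trans (Finset.sum_le_sum fun j _ => by simp [norm_smul, m])
      calc _ = ‖v‖ ^ N * ‖osc ν ρ F ψ v‖ * ‖v‖ := by ring
        _ ≤ ‖v‖ ^ N * ‖osc ν ρ F ψ v‖ * ∑ j, ‖m j v‖ * ‖b j‖ := by gcongr
        _ = ∑ j, ‖v‖ ^ N * (‖m j v‖ * ‖osc ν ρ F ψ v‖) * ‖b j‖ := by
            rw [Finset.mul_sum]; exact Finset.sum_congr rfl fun j _ => by ring
        _ ≤ _ := by gcongr with j _; exact hcoord j v hv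

/-- The amplitude of the part of the derivative of `osc ν ρ F ψ` coming from the linear form. -/
def linAmplitude (ρ : W →L[ℝ] V →L[ℝ] V) (l : V →L[ℝ] ℝ) (ψ : W → E) (x : W) : V →L[ℝ] E :=
  ContinuousLinearMap.smulRightL ℝ V E (l.comp (ρ x)) (Complex.I • ψ x)

/-- The amplitude of the part of the derivative of `osc ν ρ F ψ` coming from the bilinear form;
it has to be contracted with the variable `v`. -/
def quadAmplitude (ρ : W →L[ℝ] V →L[ℝ] V) (B : V →L[ℝ] V →L[ℝ] ℝ) (ψ : W → E) (x : W) :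
    V →L[ℝ] V →L[ℝ] E :=
  ((ContinuousLinearMap.smulRightL ℝ V E).flip (Complex.I • ψ x)).comp
    (((ContinuousLinearMap.compL ℝ V V ℝ).flip (ρ x)).comp (B.comp (ρ x)))

lemma IsAmplitude.linAmplitude [CompleteSpace V] (hψ : IsAmplitude ρ ψ) (l : V →L[ℝ] ℝ) :
    IsAmplitude ρ (linAmplitude ρ l ψ) := by
  refine hψ.of_contDiffOn (ContDiff.contDiffOn ?_) fun x hx => by
    simp [SecondDegree.linAmplitude, hx]
  have h := hψ.contDiff
  unfold SecondDegree.linAmplitude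
  fun_prop

lemma IsAmplitude.quadAmplitude [CompleteSpace V] (hψ : IsAmplitude ρ ψ)
    (B : V →L[ℝ] V →L[ℝ] ℝ) : IsAmplitude ρ (quadAmplitude ρ B ψ) := by
  refine hψ.of_contDiffOn (ContDiff.contDiffOn ?_) fun x hx => by
    simp [SecondDegree.quadAmplitude, hx]
  have h := hψ.contDiff
  unfold SecondDegree.quadAmplitude
  fun_prop

lemma hasFDerivAt_osc [BorelSpace W] [FiniteDimensional ℝ W] [CompleteSpace V]
    (ν : Measure W) [IsFiniteMeasureOnCompacts ν] (hF : IsGaussian F B l)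
    (hψ : IsAmplitude ρ ψ) (v : V) :
    HasFDerivAt (osc ν ρ F ψ)
      (osc ν ρ F (linAmplitude ρ l ψ) v + osc ν ρ F (quadAmplitude ρ B ψ) v v) v := by
  have hFc : ∀ v, Continuous fun x => F (ρ x v) :=
    fun v => hF.continuous.comp (ρ.flip v).continuous
  have h1 := integrable_mul_smul (ν := ν) (hψ.linAmplitude l) (hFc v)
  have h2 := integrable_mul_smul (ν := ν) (hψ.quadAmplitude B) (hFc v)
  have h2' : Integrable (fun x => F (ρ x v) • quadAmplitude ρ B ψ x v) ν :=
    h2.apply_continuousLinearMap v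
  have hderiv := hasFDerivAt_integral_of_dominated_of_fderiv_le (𝕜 := ℝ) (μ := ν) (x₀ := v)
    (s := Metric.ball v 1)
    (F := fun v x => F (ρ x v) • ψ x)
    (F' := fun v x => F (ρ x v) • (linAmplitude ρ l ψ x + quadAmplitude ρ B ψ x v))
    (bound := fun x => ‖linAmplitude ρ l ψ x‖ + ‖quadAmplitude ρ B ψ x‖ * (‖v‖ + 1))
    (Metric.ball_mem_nhds v one_pos)
    (.of_forall fun w => (integrable_mul_smul hψ (hFc w)).aestronglyMeasurable)
    (integrable_mul_smul hψ (hFc v))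
    (by simp only [smul_add]; exact (h1.add h2').aestronglyMeasurable)
    (.of_forall fun x w hw => by
      have hw' : ‖w‖ ≤ ‖v‖ + 1 := by
        have := norm_le_norm_add_norm_sub' w v
        rw [mem_ball_iff_norm] at hw
        linarith
      rw [norm_smul, hF.norm_eq_one, one_mul]
      refine (norm_add_le _ _).trans ?_
      gcongr
      exact (ContinuousLinearMap.le_opNorm _ _).trans (by gcongr))
    (by
      have ha := (hψ.linAmplitude l)
      have hb := (hψ.quadAmplitude B)
      exact (ha.contDiff.continuous.integrable_of_hasCompactSupport ha.hasCompactSupport).norm.add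
        ((hb.contDiff.continuous.integrable_of_hasCompactSupport
          hb.hasCompactSupport).norm.mul_const _))
    (.of_forall fun x w _ => by
      have := (HasFDerivAt.comp (g := F) (f := ρ x) w (hF.hasFDerivAt (ρ x w))
        (ρ x).hasFDerivAt).smul_const (ψ x)
      refine this.congr_fderiv ?_
      ext u
      simp only [linAmplitude, quadAmplitude, ContinuousLinearMap.smulRightL_apply_apply,
        ContinuousLinearMap.comp_apply, ContinuousLinearMap.flip_apply, add_apply,
        smul_apply, ContinuousLinearMap.smulRight_apply,
        ContinuousLinearMap.compL_apply, Complex.ofRealCLM_apply]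
      rw [← ofReal_smul_eq, ← ofReal_smul_eq, smul_smul, smul_smul, ← add_smul, smul_smul]
      congr 1
      simp
      ring)
  refine hderiv.congr_fderiv ?_
  simp only [smul_add]
  rw [integral_add h1 h2']
  congr 1
  rw [osc, ContinuousLinearMap.integral_apply h2]
  rfl

lemma contDiff_osc_nat [BorelSpace W] [FiniteDimensional ℝ W] [CompleteSpace V]
    (ν : Measure W) [IsFiniteMeasureOnCompacts ν] (hF : IsGaussian F B l) (n : ℕ) :
    ∀ {E : Type} [NormedAddCommGroup E] [NormedSpace ℝ E] [NormedSpace ℂ E] [IsScalarTower ℝ ℂ E]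
      {ψ : W → E}, IsAmplitude ρ ψ → ContDiff ℝ n (osc ν ρ F ψ) := by
  induction n with
  | zero =>
    intro E _ _ _ _ ψ hψ
    exact contDiff_zero.2 (continuous_iff_continuousAt.2 fun v =>
      (hasFDerivAt_osc ν hF hψ v).continuousAt)
  | succ n ih =>
    intro E _ _ _ _ ψ hψ
    push_cast
    refine contDiff_succ_iff_fderiv.2 ⟨fun v => (hasFDerivAt_osc ν hF hψ v).differentiableAt,
      by simp, ?_⟩
    rw [funext fun v => (hasFDerivAt_osc ν hF hψ v).fderiv]
    exact (ih (hψ.linAmplitude l)).add ((ih (hψ.quadAmplitude B)).clm_apply contDiff_id)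

lemma contDiff_osc [BorelSpace W] [FiniteDimensional ℝ W] [CompleteSpace V]
    (ν : Measure W) [IsFiniteMeasureOnCompacts ν] (hF : IsGaussian F B l)
    (hψ : IsAmplitude ρ ψ) : ContDiff ℝ ∞ (osc ν ρ F ψ) :=
  contDiff_infty.2 fun n => contDiff_osc_nat ν hF n hψ

/-- Derivatives of an oscillatory integral are oscillatory integrals with polynomial factors, so
they inherit the rapid decay. -/
lemma exists_norm_pow_mul_iteratedFDeriv_osc_le [BorelSpace W] [FiniteDimensional ℝ W]
    [FiniteDimensional ℝ V]
    (ν : Measure W) [ν.IsAddHaarMeasure] (hF : IsGaussian F B l)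
    (hB : ∀ z, (∀ x, B x z = 0) → z = 0)
    (hρ : ∀ v ≠ 0, Function.Surjective fun h => ρ h v) (n : ℕ) :
    ∀ {E : Type} [NormedAddCommGroup E] [NormedSpace ℝ E] [NormedSpace ℂ E] [IsScalarTower ℝ ℂ E]
      {ψ : W → E}, IsAmplitude ρ ψ →
      ∀ N : ℕ, ∃ C, ∀ v, ‖v‖ ^ N * ‖iteratedFDeriv ℝ n (osc ν ρ F ψ) v‖ ≤ C := by
  have := FiniteDimensional.complete ℝ V
  induction n using Nat.strong_induction_on with
  | _ n ih =>
    intro E _ _ _ _ ψ hψ N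
    match n with
    | 0 => simpa using exists_norm_pow_mul_osc_le ν hF hB hρ N hψ
    | n + 1 =>
      have hl := hψ.linAmplitude l
      have hq := hψ.quadAmplitude B
      obtain ⟨C₀, hC₀⟩ := ih n (by omega) hl N
      choose k D hD using (Function.HasTemperateGrowth.id (E := V)).2
      have hterm : ∀ i : Fin (n + 1), ∃ C, ∀ v : V, ‖v‖ ^ N *
          (‖iteratedFDeriv ℝ i (osc ν ρ F (quadAmplitude ρ B ψ)) v‖ *
            (D (n - i) * (1 + ‖v‖) ^ k (n - i))) ≤ C := by
        intro i
        choose C hC using fun a => ih i (by omega) hq (N + a)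
        refine ⟨∑ a ∈ Finset.range (k (n - i) + 1),
          |D (n - i)| * (k (n - i)).choose a * C a, fun v => ?_⟩
        calc _ ≤ ‖v‖ ^ N *
          (‖iteratedFDeriv ℝ i (osc ν ρ F (quadAmplitude ρ B ψ)) v‖ *
            (|D (n - i)| * (1 + ‖v‖) ^ k (n - i))) := by gcongr; exact le_abs_self _
          _ = ∑ a ∈ Finset.range (k (n - i) + 1), |D (n - i)| * (k (n - i)).choose a *
                (‖v‖ ^ (N + a) * ‖iteratedFDeriv ℝ i (osc ν ρ F (quadAmplitude ρ B ψ)) v‖) := by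
              rw [add_comm (1 : ℝ), add_pow, Finset.mul_sum, Finset.mul_sum, Finset.mul_sum]
              refine Finset.sum_congr rfl fun a _ => ?_
              rw [pow_add, one_pow]
              ring
          _ ≤ _ := by gcongr with a _; exact hC a v
      choose C hC using hterm
      refine ⟨C₀ + ∑ i : Fin (n + 1), n.choose i * C i, fun v => ?_⟩
      rw [← norm_iteratedFDeriv_fderiv, funext fun v => (hasFDerivAt_osc ν hF hψ v).fderiv]
      have hc1 : ContDiff ℝ n (osc ν ρ F (linAmplitude ρ l ψ)) := contDiff_osc_nat ν hF n hl
      have hc2 : ContDiff ℝ n (osc ν ρ F (quadAmplitude ρ B ψ)) := contDiff_osc_nat ν hF n hq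
      have hadd := iteratedFDeriv_add_apply (x := v) (i := n) hc1.contDiffAt
        (hc2.clm_apply contDiff_id).contDiffAt
      have hclm := norm_iteratedFDeriv_clm_apply hc2 (contDiff_id (E := V)) v le_rfl
      calc _ ≤ ‖v‖ ^ N * (‖iteratedFDeriv ℝ n (osc ν ρ F (linAmplitude ρ l ψ)) v‖ +
            ∑ i ∈ Finset.range (n + 1), n.choose i *
              ‖iteratedFDeriv ℝ i (osc ν ρ F (quadAmplitude ρ B ψ)) v‖ *
              ‖iteratedFDeriv ℝ (n - i) (id : V → V) v‖) := by
            gcongr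
            refine (le_of_eq (congrArg norm hadd)).trans ((norm_add_le _ _).trans ?_)
            gcongr
        _ = ‖v‖ ^ N * ‖iteratedFDeriv ℝ n (osc ν ρ F (linAmplitude ρ l ψ)) v‖ +
            ∑ i : Fin (n + 1), n.choose i * (‖v‖ ^ N *
              (‖iteratedFDeriv ℝ i (osc ν ρ F (quadAmplitude ρ B ψ)) v‖ *
              ‖iteratedFDeriv ℝ (n - i) (id : V → V) v‖)) := by
            rw [mul_add, Finset.mul_sum, Finset.sum_range]
            congr 1
            exact Finset.sum_congr rfl fun i _ => by ring
        _ ≤ _ := by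
            gcongr with i _
            · exact hC₀ v
            · refine le_trans ?_ (hC i v)
              gcongr
              exact hD _ v

/-- An oscillatory integral with a non-degenerate quadratic phase is a Schwartz function. -/
theorem exists_schwartzMap_eq_osc [BorelSpace W] [FiniteDimensional ℝ W] [FiniteDimensional ℝ V]
    (ν : Measure W) [ν.IsAddHaarMeasure] (hF : IsGaussian F B l)
    (hB : ∀ z, (∀ x, B x z = 0) → z = 0)
    (hρ : ∀ v ≠ 0, Function.Surjective fun h => ρ h v) (hψ : IsAmplitude ρ ψ) :
    ∃ g : SchwartzMap V E, ∀ v, g v = osc ν ρ F ψ v := by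
  have := FiniteDimensional.complete ℝ V
  exact ⟨⟨osc ν ρ F ψ, contDiff_osc ν hF hψ, fun k n =>
    exists_norm_pow_mul_iteratedFDeriv_osc_le ν hF hB hρ n hψ k⟩, fun _ => rfl⟩

end OscillatorySchwartz

/-! ### Second degree characters of real vector spaces -/

section RealCharacters

/-- A map that is additive and continuous in each variable is a continuous real bilinear map. -/
lemma exists_bilinear {E F G : Type*} [NormedAddCommGroup E] [NormedSpace ℝ E]
    [NormedAddCommGroup F] [NormedSpace ℝ F] [FiniteDimensional ℝ F]
    [NormedAddCommGroup G] [NormedSpace ℝ G] (β : E → F → G)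
    (hl : ∀ x x' y, β (x + x') y = β x y + β x' y) (hr : ∀ x y y', β x (y + y') = β x y + β x y')
    (hcl : ∀ y, Continuous fun x => β x y) (hcr : ∀ x, Continuous (β x)) :
    ∃ B : E →L[ℝ] F →L[ℝ] G, ∀ x y, B x y = β x y := by
  let B₁ : E → F →L[ℝ] G := fun x => (AddMonoidHom.mk' (β x) (hr x)).toRealLinearMap (hcr x)
  have hB₁ : Continuous B₁ := continuous_clm_apply.2 hcl
  exact ⟨(AddMonoidHom.mk' B₁ fun x x' => by ext y; exact hl x x' y).toRealLinearMap hB₁,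
    fun _ _ => rfl⟩

section Basic

variable {V : Type*} [AddCommGroup V] [TopologicalSpace V] {f : V → Circle}

lemma IsSecondDegreeCharacter.polar_zero_left (hf : IsSecondDegreeCharacter f) (y : V) :
    polar f 0 y = 1 := by
  simpa using hf.polar_add_left 0 0 y

lemma IsSecondDegreeCharacter.map_zero (hf : IsSecondDegreeCharacter f) : f 0 = 1 := by
  simpa [polar] using hf.polar_zero_left 0

lemma map_add_eq (f : V → Circle) (x y : V) : f (x + y) = f x * f y * polar f x y := by
  simp only [polar]
  rw [mul_assoc (f (x + y)), ← mul_inv, mul_comm, mul_assoc, inv_mul_cancel, mul_one]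

lemma polar_comm (f : V → Circle) (x y : V) : polar f x y = polar f y x := by
  rw [polar, polar, add_comm, mul_right_comm]

lemma IsNondegenerate.eq_zero (h : IsNondegenerate f) {y : V} (hy : ∀ x, polar f x y = 1) :
    y = 0 := by
  obtain ⟨ϱ, hϱ⟩ := h
  have : ϱ (Multiplicative.ofAdd y) = 1 := by
    ext x
    exact congrArg _ ((hϱ x.toAdd y).trans (hy _))
  simpa using (map_eq_one_iff ϱ ϱ.injective).1 this

end Basic

variable {V : Type} [NormedAddCommGroup V] [NormedSpace ℝ V] [FiniteDimensional ℝ V]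

/-- A second degree character of a real vector space lifts through `Circle.exp` to a polynomial of
degree two: the polarization of the continuous lift is additive in both variables, because its
defect of additivity is continuous and takes values in `2 π ℤ`. -/
lemma IsSecondDegreeCharacter.exists_isGaussian {f : V → Circle} (hf : IsSecondDegreeCharacter f) :
    ∃ (B : V →L[ℝ] V →L[ℝ] ℝ) (l : V →L[ℝ] ℝ), IsGaussian (fun x => (f x : ℂ)) B l ∧
      ∀ x y, polar f x y = Circle.exp (B x y) := by
  have : LocallyPathConnectedSpace V := inferInstance
  obtain ⟨θ, ⟨hθ0, hθ⟩, -⟩ := Circle.isCoveringMap_exp.existsUnique_continuousMap_lifts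
    ⟨f, hf.continuous⟩ 0 0 (by simp [hf.map_zero])
  replace hθ : ∀ x, Circle.exp (θ x) = f x := fun x => congrFun hθ x
  let b : V → V → ℝ := fun x y => θ (x + y) - θ x - θ y
  have hb : ∀ x y, Circle.exp (b x y) = polar f x y := by
    intro x y
    simp only [b, Circle.exp_sub, hθ, polar, div_eq_mul_inv]
  have hbsymm : ∀ x y, b x y = b y x := by
    intro x y
    simp only [b, add_comm y x]
    ring
  have hbl : ∀ x x' y, b (x + x') y = b x y + b x' y := by
    intro x x' y
    have hc : Continuous fun y => b (x + x') y - b x y - b x' y := by fun_prop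
    have hone : ∀ y, Circle.exp (b (x + x') y - b x y - b x' y) = 1 := by
      intro y
      rw [Circle.exp_sub, Circle.exp_sub, hb, hb, hb, hf.polar_add_left, div_div, div_self']
    have hconst := Circle.isCoveringMap_exp.eq_of_comp_eq hc (continuous_const (y := (0 : ℝ)))
      (funext fun y => by simp [hone]) 0 (by simp [b, hθ0])
    have := congrFun hconst y
    linarith
  obtain ⟨B, hB⟩ := exists_bilinear b hbl
    (fun x y y' => by rw [hbsymm, hbl, hbsymm y, hbsymm y'])
    (fun y => by fun_prop) (fun x => by fun_prop)
  let q : V →+ ℝ := AddMonoidHom.mk' (fun x => θ x - B x x / 2) fun x y => by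
    have h1 : θ (x + y) = θ x + θ y + B x y := by rw [hB]; simp only [b]; ring
    have h2 : B y x = B x y := by rw [hB, hB, hbsymm]
    simp only [map_add, add_apply, h1, h2]
    ring
  let l : V →L[ℝ] ℝ := q.toRealLinearMap (by
    change Continuous fun x => θ x - B x x / 2
    fun_prop)
  have hl : ∀ x, θ x = B x x / 2 + l x := fun x => by
    change _ = _ + (θ x - B x x / 2); ring
  refine ⟨B, l, ⟨fun x => Circle.norm_coe (f x), fun x => ?_⟩, fun x y => by rw [hB, hb]⟩
  have hθd : HasFDerivAt θ (B x + l) x := by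
    have h1 : HasFDerivAt (fun x => B x x) ((B x).comp (.id ℝ V) + (B.flip x)) x := by
      have := (B.hasFDerivAt (x := x)).clm_apply (hasFDerivAt_id x)
      exact this
    have h2 := (h1.mul_const (1 / 2 : ℝ)).add (l.hasFDerivAt (x := x))
    rw [show (θ : V → ℝ) = fun x => B x x * (1 / 2) + l x from funext fun x => by rw [hl]; ring]
    refine h2.congr_fderiv ?_
    ext y
    have h3 : B y x = B x y := by rw [hB, hB, hbsymm]
    simp [h3]
    ring
  have hfe : (fun x => (f x : ℂ)) = fun x => Complex.exp (Complex.ofRealCLM (θ x) * Complex.I) := by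
    funext x
    rw [← hθ x, Circle.coe_exp]; rfl
  rw [show (f x : ℂ) = Complex.exp (Complex.ofRealCLM (θ x) * Complex.I) from congrFun hfe x, hfe]
  refine (((Complex.ofRealCLM.hasFDerivAt.comp x hθd).mul_const Complex.I).cexp).congr_fderiv ?_
  ext y
  simp
  ring

end RealCharacters

/-! ### Haar measure on the unit group of a locally compact ring -/

section HaarUnits

variable {A : Type*} [Ring A] [TopologicalSpace A] [IsTopologicalRing A] [T2Space A]
  [LocallyCompactSpace A]
  [MeasurableSpace A] [BorelSpace A] [MeasurableSpace Aˣ] [BorelSpace Aˣ]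

/-- If `δ g` is the factor by which left multiplication by `g` scales additive Haar measure, then
the additive Haar measure divided by `δ` is a left invariant measure on the units, hence a
multiple of their Haar measure. -/
theorem exists_integral_units_eq (hopen : IsOpenEmbedding (Units.val : Aˣ → A))
    (ν : Measure A) [ν.IsAddHaarMeasure] (δ : Aˣ →* ℝ≥0) (hδ : Continuous δ)
    (hν : ∀ g : Aˣ, δ g • ν.map (fun x => (g : A) * x) = ν)
    (μ : Measure Aˣ) [μ.IsHaarMeasure] :
    ∃ c : ℂ, ∀ Φ : Aˣ → ℂ, Continuous Φ → HasCompactSupport Φ →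
      ∫ g, Φ g ∂μ =
        c * ∫ x, Function.extend Units.val (fun g => ((δ g)⁻¹ : ℝ≥0) • Φ g) 0 x ∂ν := by
  have : LocallyCompactSpace Aˣ := hopen.locallyCompactSpace
  have : T2Space Aˣ := hopen.isEmbedding.t2Space
  have hemb : MeasurableEmbedding (Units.val : Aˣ → A) := hopen.measurableEmbedding
  have hδ0 : ∀ g, δ g ≠ 0 := fun g h => by
    have := map_mul δ g g⁻¹
    simp [h] at this
  have hδi : Continuous fun g => (δ g)⁻¹ := hδ.inv₀ hδ0
  let ν₁ : Measure Aˣ := ν.comap Units.val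
  let w : Aˣ → ℝ≥0∞ := fun g => ((δ g)⁻¹ : ℝ≥0)
  have hw : Measurable w := (ENNReal.continuous_coe.comp hδi).measurable
  let ν' : Measure Aˣ := ν₁.withDensity w
  have hmapν₁ : ∀ h : Aˣ, δ h • ν₁.map (fun g => h * g) = ν₁ := by
    intro h
    ext s hs
    have hpre : Units.val '' ((fun g => h * g) ⁻¹' s) =
        (fun x => (h : A) * x) ⁻¹' (Units.val '' s) := by
      ext x
      constructor
      · rintro ⟨g, hg, rfl⟩
        exact ⟨h * g, hg, rfl⟩
      · rintro ⟨g, hg, hgx⟩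
        refine ⟨h⁻¹ * g, by simpa using hg, ?_⟩
        rw [Units.val_mul, hgx, Units.inv_mul_cancel_left]
    rw [Measure.smul_apply, Measure.map_apply (measurable_const_mul h) hs,
      hemb.comap_apply, hemb.comap_apply, hpre,
      ← Measure.map_apply (measurable_const_mul (h : A)) (hemb.measurableSet_image.2 hs),
      ← Measure.smul_apply, hν]
  have hinv : ν'.IsMulLeftInvariant := by
    refine ⟨fun h => ?_⟩
    ext s hs
    rw [Measure.map_apply (measurable_const_mul h) hs, withDensity_apply _ hs,
      withDensity_apply _ (measurable_const_mul h hs), ← lintegral_indicator hs,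
      ← lintegral_indicator (measurable_const_mul h hs)]
    conv_rhs => rw [← hmapν₁ h]
    rw [lintegral_smul_measure, lintegral_map (hw.indicator hs) (measurable_const_mul h),
      ENNReal.smul_def, smul_eq_mul, ← lintegral_const_mul _
        (show Measurable fun g => s.indicator w (h * g) from
          (hw.indicator hs).comp (measurable_const_mul h))]
    congr 1 with g
    by_cases hg : h * g ∈ s
    · rw [Set.indicator_of_mem (by exact hg), Set.indicator_of_mem hg]
      simp only [w]
      rw [← ENNReal.coe_mul]
      congr 1
      rw [map_mul]
      field_simp [hδ0 h, hδ0 g]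
    · rw [Set.indicator_of_notMem (by exact hg), Set.indicator_of_notMem hg, mul_zero]
  have hfin₁ : IsFiniteMeasureOnCompacts ν₁ := ⟨fun K hK => by
    rw [hemb.comap_apply]
    exact (hK.image hopen.continuous).measure_lt_top⟩
  have hfin : IsFiniteMeasureOnCompacts ν' := ⟨fun K hK => by
    obtain ⟨C, hC⟩ := (hK.image hδi).bddAbove
    refine lt_of_le_of_lt (b := C * ν₁ K) ?_ (ENNReal.mul_lt_top (by simp) hK.measure_lt_top)
    rw [withDensity_apply _ hK.measurableSet, ← setLIntegral_const]
    exact setLIntegral_mono' hK.measurableSet fun g hg =>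
      ENNReal.coe_le_coe.2 (hC (Set.mem_image_of_mem _ hg))⟩
  have hpos₁ : ν₁.IsOpenPosMeasure := ⟨fun U hU hne => by
    rw [hemb.comap_apply]
    exact (hopen.isOpenMap U hU).measure_ne_zero ν (hne.image _)⟩
  have hpos : ν'.IsOpenPosMeasure :=
    (withDensity_absolutelyContinuous' hw.aemeasurable
      (.of_forall fun g => by simp [w, hδ0 g])).isOpenPosMeasure
  have hhaar : ν'.IsHaarMeasure := {}
  let c := Measure.haarScalarFactor μ ν'
  have hreal : ∀ f : Aˣ → ℝ, Continuous f → HasCompactSupport f →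
      ∫ g, f g ∂μ = c * ∫ g, f g ∂ν' := by
    intro f hf hf'
    rw [Measure.integral_isMulLeftInvariant_eq_smul_of_hasCompactSupport μ ν' hf hf',
      integral_smul_nnreal_measure]
    rfl
  refine ⟨(c : ℝ), fun Φ hΦ hΦ' => ?_⟩
  have hre := hreal _ (Complex.continuous_re.comp hΦ) (hΦ'.comp_left (g := Complex.re) rfl)
  have him := hreal _ (Complex.continuous_im.comp hΦ) (hΦ'.comp_left (g := Complex.im) rfl)
  have hcplx : ∫ g, Φ g ∂μ = (c : ℝ) * ∫ g, Φ g ∂ν' := by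
    rw [← integral_re_add_im (hΦ.integrable_of_hasCompactSupport hΦ'),
      ← integral_re_add_im (μ := ν') (hΦ.integrable_of_hasCompactSupport hΦ')]
    simp only [Function.comp_def] at hre him
    simp only [RCLike.re_to_complex, RCLike.im_to_complex, hre, him]
    simp
    ring
  rw [hcplx, integral_withDensity_eq_integral_smul hδi.measurable]
  congr 1
  have h1 : ∀ g, (δ g)⁻¹ • Φ g =
      Function.extend Units.val (fun g => ((δ g)⁻¹ : ℝ≥0) • Φ g) 0 (g : A) := fun g =>
    (hopen.injective.extend_apply (fun g => ((δ g)⁻¹ : ℝ≥0) • Φ g) 0 g).symm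
  rw [integral_congr_ae (.of_forall h1)]
  rw [← hemb.integral_map, hemb.map_comap]
  refine setIntegral_eq_integral_of_forall_compl_eq_zero fun x hx => ?_
  rw [Function.extend_apply' _ _ _ fun ⟨g, hg⟩ => hx ⟨g, hg⟩]
  rfl

end HaarUnits

section ChangeOfVariables

open Matrix

variable {L : Type*} [Field L] [TopologicalSpace L] {n : ℕ}

lemma isOpenEmbedding_val_GL [IsTopologicalDivisionRing L] [T2Space L] :
    IsOpenEmbedding (Units.val : GL (Fin n) L → Matrix (Fin n) (Fin n) L) := by
  refine ⟨Units.isEmbedding_val_mk' (f := fun X => X⁻¹) (fun X hX => ?_)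
    fun u => (Matrix.coe_units_inv u).symm, ?_⟩
  · refine ContinuousAt.continuousWithinAt (continuousAt_matrix_inv X ?_)
    rw [Ring.inverse_eq_inv']
    exact continuousAt_inv₀ ((Matrix.isUnit_iff_isUnit_det X).1 hX).ne_zero
  · have : Set.range (Units.val : GL (Fin n) L → Matrix (Fin n) (Fin n) L) =
        (fun X => X.det) ⁻¹' {0}ᶜ := by
      ext X
      rw [Set.mem_preimage, Set.mem_compl_singleton_iff, ← isUnit_iff_ne_zero,
        ← Matrix.isUnit_iff_isUnit_det]
      rfl
    rw [this]
    exact isOpen_compl_singleton.preimage (continuous_id.matrix_det)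

/-- The automorphism `g ↦ (gᵀ)⁻¹` of `GL_n(L)`. -/
def invTranspose [IsTopologicalRing L] : GL (Fin n) L ≃ₜ* GL (Fin n) L where
  toFun g := ⟨(g⁻¹).valᵀ, g.valᵀ, by rw [← transpose_mul, Units.mul_inv, transpose_one],
    by rw [← transpose_mul, Units.inv_mul, transpose_one]⟩
  invFun g := ⟨(g⁻¹).valᵀ, g.valᵀ, by rw [← transpose_mul, Units.mul_inv, transpose_one],
    by rw [← transpose_mul, Units.inv_mul, transpose_one]⟩
  left_inv g := by ext1; simp [← Units.inv_eq_val_inv]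
  right_inv g := by ext1; simp [← Units.inv_eq_val_inv]
  map_mul' g h := by ext1; simp [transpose_mul]
  continuous_toFun := Units.continuous_iff.2
    ⟨Units.continuous_coe_inv.matrix_transpose, Units.continuous_val.matrix_transpose⟩
  continuous_invFun := Units.continuous_iff.2
    ⟨Units.continuous_coe_inv.matrix_transpose, Units.continuous_val.matrix_transpose⟩

lemma invTranspose_invTranspose [IsTopologicalRing L] (g : GL (Fin n) L) :
    invTranspose (invTranspose g) = g :=
  invTranspose.left_inv g

/-- The function on `M_n(L)` that is `φ ((gᵀ)⁻¹) / δ g` at invertible `g` and zero elsewhere;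
`δ` will be the factor by which left multiplication scales the measure of `M_n(L)`. -/
def matrixAmplitude [IsTopologicalRing L] (δ : GL (Fin n) L →* ℝ≥0) (φ : GL (Fin n) L → ℂ) :
    Matrix (Fin n) (Fin n) L → ℂ :=
  Function.extend Units.val (fun g => ((δ g)⁻¹ : ℝ≥0) • φ (invTranspose g)) 0

lemma matrixAmplitude_val [IsTopologicalRing L] (δ : GL (Fin n) L →* ℝ≥0) (φ : GL (Fin n) L → ℂ)
    (g : GL (Fin n) L) :
    matrixAmplitude δ φ g.val = ((δ g)⁻¹ : ℝ≥0) • φ (invTranspose g) :=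
  Function.Injective.extend_apply Units.val_injective
    (fun g => ((δ g)⁻¹ : ℝ≥0) • φ (invTranspose g)) 0 g

lemma exists_isCompact_matrixAmplitude [IsTopologicalRing L] (δ : GL (Fin n) L →* ℝ≥0)
    {φ : GL (Fin n) L → ℂ} (hφ : HasCompactSupport φ) :
    ∃ S : Set (Matrix (Fin n) (Fin n) L), IsCompact S ∧ (∀ X ∈ S, IsUnit X) ∧
      ∀ X, X ∉ S → matrixAmplitude δ φ X = 0 := by
  refine ⟨Units.val '' (invTranspose '' tsupport φ),
    (hφ.isCompact.image invTranspose.continuous_toFun).image Units.continuous_val, ?_, ?_⟩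
  · rintro _ ⟨g, -, rfl⟩
    exact g.isUnit
  · intro X hX
    by_cases h : ∃ g : GL (Fin n) L, g.val = X
    · obtain ⟨g, rfl⟩ := h
      rw [matrixAmplitude_val]
      by_cases h0 : φ (invTranspose g) = 0
      · rw [h0, smul_zero]
      · exact absurd ⟨g, ⟨invTranspose g, subset_tsupport _ h0, invTranspose_invTranspose g⟩, rfl⟩
          hX
    · exact Function.extend_apply' _ _ _ h

lemma continuous_circle_coe : Continuous fun z : Circle => (z : ℂ) := continuous_induced_dom

lemma integrable_integrand [IsTopologicalDivisionRing L] [T2Space L]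
    [MeasurableSpace (GL (Fin n) L)] [BorelSpace (GL (Fin n) L)]
    (μ : Measure (GL (Fin n) L)) [IsFiniteMeasureOnCompacts μ] {f : (Fin n → L) → Circle}
    (hf : Continuous f) {φ : GL (Fin n) L → ℂ} (hφ : Continuous φ) (hφ' : HasCompactSupport φ)
    (v : Fin n → L) : Integrable (integrand φ f v) μ := by
  refine Continuous.integrable_of_hasCompactSupport (hφ.mul ?_) hφ'.mul_right
  exact continuous_circle_coe.comp (hf.comp (Units.continuous_coe_inv.matrix_mulVec
    continuous_const))

/-- The Haar integral `λ(φ)f(v)` as an integral over `M_n(L)` of `f (Xᵀ v)`, in which the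
argument of `f` depends linearly on the variable of integration. -/
theorem exists_lam_eq [IsTopologicalDivisionRing L] [T2Space L] [LocallyCompactSpace L]
    [MeasurableSpace (GL (Fin n) L)] [BorelSpace (GL (Fin n) L)]
    [MeasurableSpace (Matrix (Fin n) (Fin n) L)] [BorelSpace (Matrix (Fin n) (Fin n) L)]
    (ν : Measure (Matrix (Fin n) (Fin n) L)) [ν.IsAddHaarMeasure]
    (δ : GL (Fin n) L →* ℝ≥0) (hδ : Continuous δ)
    (hν : ∀ g : GL (Fin n) L, δ g • ν.map (fun X => g.val * X) = ν)
    (μ : Measure (GL (Fin n) L)) [μ.IsHaarMeasure] {f : (Fin n → L) → Circle}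
    (hf : Continuous f) {φ : GL (Fin n) L → ℂ} (hφ : Continuous φ) (hφ' : HasCompactSupport φ) :
    ∃ c : ℂ, ∀ v, lam μ φ f v = c * ∫ X, matrixAmplitude δ φ X * (f (Xᵀ *ᵥ v) : ℂ) ∂ν := by
  have : LocallyCompactSpace (Matrix (Fin n) (Fin n) L) :=
    inferInstanceAs (LocallyCompactSpace (Fin n → Fin n → L))
  have hμ' : (μ.map invTranspose).IsHaarMeasure := invTranspose.isHaarMeasure_map μ
  obtain ⟨c, hc⟩ := exists_integral_units_eq isOpenEmbedding_val_GL ν δ hδ hν (μ.map invTranspose)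
  have hτ : Continuous (invTranspose : GL (Fin n) L → GL (Fin n) L) := invTranspose.continuous_toFun
  refine ⟨c, fun v => ?_⟩
  have h1 : lam μ φ f v = ∫ g, φ (invTranspose g) * (f (g.valᵀ *ᵥ v) : ℂ)
      ∂(μ.map invTranspose) := by
    refine Eq.symm (((invTranspose (L := L) (n := n)).toHomeomorph.measurableEmbedding.integral_map
      (fun g => φ (invTranspose g) * (f (g.valᵀ *ᵥ v) : ℂ))).trans ?_)
    refine integral_congr_ae (.of_forall fun g => ?_)
    change φ (invTranspose (invTranspose g)) * (f ((invTranspose g).valᵀ *ᵥ v) : ℂ) = _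
    rw [invTranspose_invTranspose]
    rfl
  have hcont : Continuous fun g : GL (Fin n) L => φ (invTranspose g) * (f (g.valᵀ *ᵥ v) : ℂ) :=
    (hφ.comp hτ).mul (continuous_circle_coe.comp (hf.comp
      (Units.continuous_val.matrix_transpose.matrix_mulVec continuous_const)))
  have hcpt : HasCompactSupport fun g : GL (Fin n) L =>
      φ (invTranspose g) * (f (g.valᵀ *ᵥ v) : ℂ) :=
    (hφ'.comp_homeomorph invTranspose.toHomeomorph).mul_right
  refine h1.trans ((hc _ hcont hcpt).trans ?_)
  congr 2 with X
  by_cases h : ∃ g : GL (Fin n) L, g.val = X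
  · obtain ⟨g, rfl⟩ := h
    rw [matrixAmplitude_val, smul_mul_assoc]
    exact Function.Injective.extend_apply Units.val_injective
      (fun g : GL (Fin n) L => ((δ g)⁻¹ : ℝ≥0) • (φ (invTranspose g) * (f (g.valᵀ *ᵥ v) : ℂ))) 0 g
  · rw [Function.extend_apply' _ _ _ h, matrixAmplitude, Function.extend_apply' _ _ _ h]
    simp

end ChangeOfVariables

/-! ### The archimedean case -/

section Archimedean

open Matrix

variable {L : Type*} [Field L] [TopologicalSpace L] {n m : ℕ}
  (e : EuclideanSpace ℝ (Fin m) ≃ₜ+ Matrix (Fin n) (Fin n) L)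

lemma continuous_of_contDiffOn {φ : GL (Fin n) L → ℂ}
    (hφ : ContDiffOn ℝ ∞
        (fun x => Function.extend (Units.val : GL (Fin n) L → Matrix (Fin n) (Fin n) L) φ 0 (e x))
        {x | IsUnit (e x)}) : Continuous φ := by
  have h := hφ.continuousOn.comp_continuous (f := fun g : GL (Fin n) L => e.symm g.val)
    (e.symm.continuous_toFun.comp Units.continuous_val) fun g => by simp [g.isUnit]
  refine h.congr fun g => ?_
  rw [Function.comp_apply, e.apply_symm_apply]
  exact Function.Injective.extend_apply Units.val_injective φ 0 g

/-- Multiplication of matrices is real bilinear in any real coordinates, as it is biadditive and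
continuous. -/
lemma exists_mulCLM [IsTopologicalRing L] :
    ∃ Λ : EuclideanSpace ℝ (Fin m) →L[ℝ] EuclideanSpace ℝ (Fin m) →L[ℝ] EuclideanSpace ℝ (Fin m),
      ∀ x y, Λ x y = e.symm (e x * e y) :=
  exists_bilinear _ (fun x x' y => by simp [add_mul]) (fun x y y' => by simp [mul_add])
    (fun y => e.symm.continuous_toFun.comp (e.continuous_toFun.mul continuous_const))
    (fun x => e.symm.continuous_toFun.comp (continuous_const.mul e.continuous_toFun))

/-- If `M_n(L)` is a real vector space then so is `L^n`: the real multiples of the identity matrix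
act on it. -/
lemma exists_euclidean_equiv [IsTopologicalDivisionRing L] [T2Space L] [LocallyCompactSpace L]
    (e : EuclideanSpace ℝ (Fin m) ≃ₜ+ Matrix (Fin n) (Fin n) L) :
    ∃ d, Nonempty (EuclideanSpace ℝ (Fin d) ≃ₜ+ (Fin n → L)) := by
  obtain ⟨Λ, hΛ⟩ := exists_mulCLM e
  let M : ℝ → Matrix (Fin n) (Fin n) L := fun r => e (r • e.symm 1)
  have hM : ∀ X r, X * M r = e (r • e.symm X) := by
    intro X r
    have h := (Λ (e.symm X)).map_smul r (e.symm 1)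
    rw [hΛ, hΛ] at h
    simpa [M] using congrArg e h
  let _ : Module ℝ (Fin n → L) :=
    { smul := fun r v => M r *ᵥ v
      one_smul := fun v => by change M 1 *ᵥ v = v; simp [M]
      mul_smul := fun r s v => by
        change M (r * s) *ᵥ v = M r *ᵥ (M s *ᵥ v)
        rw [mulVec_mulVec, hM]
        simp only [M, ContinuousAddEquiv.symm_apply_apply, smul_smul, mul_comm]
      smul_zero := fun r => mulVec_zero _
      smul_add := fun r v w => mulVec_add _ _ _
      add_smul := fun r s v => by
        change M (r + s) *ᵥ v = M r *ᵥ v + M s *ᵥ v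
        simp only [M, add_smul, map_add, add_mulVec]
      zero_smul := fun v => by change M 0 *ᵥ v = 0; simp [M] }
  have hMc : Continuous M := e.continuous_toFun.comp (continuous_id.smul continuous_const)
  have : ContinuousSMul ℝ (Fin n → L) :=
    ⟨(hMc.comp continuous_fst).matrix_mulVec continuous_snd⟩
  have : FiniteDimensional ℝ (Fin n → L) := FiniteDimensional.of_locallyCompactSpace ℝ
  exact ⟨_, ⟨(toEuclidean (E := Fin n → L)).symm.toContinuousAddEquiv⟩⟩

lemma contDiff_det {W X : Type*} [NormedAddCommGroup W] [NormedSpace ℝ W] [NormedAddCommGroup X]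
    [NormedSpace ℝ X] [FiniteDimensional ℝ X] (Λ : W →L[ℝ] X →L[ℝ] X) :
    ContDiff ℝ ∞ fun x => LinearMap.det (Λ x : X →ₗ[ℝ] X) := by
  let b := Module.finBasis ℝ X
  have h : (fun x => LinearMap.det (Λ x : X →ₗ[ℝ] X)) = fun x =>
      ∑ σ : Equiv.Perm (Fin (finrank ℝ X)), (Equiv.Perm.sign σ : ℝ) *
        ∏ i, LinearMap.toContinuousLinearMap (b.coord (σ i)) (Λ x (b i)) := by
    funext x
    rw [← LinearMap.det_toMatrix b, Matrix.det_apply']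
    simp only [LinearMap.toMatrix_apply]
    rfl
  rw [h]
  refine ContDiff.sum fun σ _ => contDiff_const.mul (contDiff_prod fun i _ => ?_)
  exact (LinearMap.toContinuousLinearMap (b.coord (σ i))).contDiff.comp
    (Λ.contDiff.clm_apply contDiff_const)

variable [IsTopologicalDivisionRing L] [T2Space L] [LocallyCompactSpace L]

/-- The archimedean case: in real coordinates, `λ(φ)f` is an oscillatory integral whose phase is a
non-degenerate quadratic polynomial. -/
theorem isSchwartzBruhat_lam_of_contDiffOn [MeasurableSpace (GL (Fin n) L)]
    [BorelSpace (GL (Fin n) L)] (μ : Measure (GL (Fin n) L)) [μ.IsHaarMeasure]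
    {f : (Fin n → L) → Circle} (hf : IsSecondDegreeCharacter f) (hnd : IsNondegenerate f)
    {φ : GL (Fin n) L → ℂ} (hφ' : HasCompactSupport φ)
    (hφ : ContDiffOn ℝ ∞
        (fun x => Function.extend (Units.val : GL (Fin n) L → Matrix (Fin n) (Fin n) L) φ 0 (e x))
        {x | IsUnit (e x)}) : IsSchwartzBruhat (lam μ φ f) := by
  obtain ⟨d, ⟨eV⟩⟩ := exists_euclidean_equiv e
  obtain ⟨Λ, hΛ⟩ := exists_mulCLM e
  have hΛmul : ∀ X Y, Λ (e.symm (X * Y)) = Λ (e.symm X) * Λ (e.symm Y) := by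
    intro X Y
    ext1 y
    simp [hΛ, mul_assoc]
  have hΛone : Λ (e.symm 1) = 1 := by
    ext1 y
    simp [hΛ]
  let Λ' : Matrix (Fin n) (Fin n) L →*
      (EuclideanSpace ℝ (Fin m) →L[ℝ] EuclideanSpace ℝ (Fin m)) :=
    { toFun := fun X => Λ (e.symm X), map_one' := hΛone, map_mul' := hΛmul }
  have hΛunit : ∀ x, IsUnit (e x) → IsUnit (Λ x) := fun x hx => by simpa [Λ'] using hx.map Λ'
  obtain ⟨ρ, hρ⟩ : ∃ ρ : EuclideanSpace ℝ (Fin m) →L[ℝ] EuclideanSpace ℝ (Fin d) →L[ℝ]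
      EuclideanSpace ℝ (Fin d), ∀ x v, ρ x v = eV.symm ((e x)ᵀ *ᵥ eV v) :=
    exists_bilinear _ (fun x x' y => by simp [add_mulVec]) (fun x y y' => by simp [mulVec_add])
      (fun y => eV.symm.continuous_toFun.comp
        (e.continuous_toFun.matrix_transpose.matrix_mulVec continuous_const))
      (fun x => eV.symm.continuous_toFun.comp
        (continuous_const.matrix_mulVec eV.continuous_toFun))
  have hρunit : ∀ x, IsUnit (e x) → IsUnit (ρ x) := by
    rintro x ⟨g, hg⟩
    have hcomp : ∀ y z, e y * e z = 1 → ρ z * ρ y = 1 := by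
      intro y z hyz
      ext1 v
      simp [hρ, ← transpose_mul, hyz]
    exact ⟨⟨ρ x, ρ (e.symm (g⁻¹).val), hcomp _ _ (by simp [← hg]), hcomp _ _ (by simp [← hg])⟩, rfl⟩
  have hρsurj : ∀ v ≠ 0, Function.Surjective fun h => ρ h v := by
    intro v hv z
    obtain ⟨j, hj⟩ := Function.ne_iff.1 (show eV v ≠ 0 by simpa using hv)
    refine ⟨e.symm (vecMulVec (Pi.single j (eV v j)⁻¹) (eV z)), ?_⟩
    simp only [hρ, ContinuousAddEquiv.apply_symm_apply, transpose_vecMulVec]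
    rw [vecMulVec_mulVec, single_dotProduct, inv_mul_cancel₀ hj]
    simp
  -- The phase, in the real coordinates `eV` of `L^n`.
  have hf' : IsSecondDegreeCharacter fun x => f (eV x) :=
    ⟨hf.continuous.comp eV.continuous_toFun,
      fun x x' y => by simpa [polar] using hf.polar_add_left (eV x) (eV x') (eV y),
      fun x y y' => by simpa [polar] using hf.polar_add_right (eV x) (eV y) (eV y')⟩
  obtain ⟨B, l, hF, hB⟩ := hf'.exists_isGaussian
  have hBnd : ∀ z, (∀ x, B x z = 0) → z = 0 := by
    intro z hz
    have : eV z = 0 := hnd.eq_zero fun y => by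
      have := hB (eV.symm y) z
      rw [hz, Circle.exp_zero] at this
      simpa [polar] using this
    simpa using this
  -- The measure: left multiplication by `g` scales it by the absolute value of a determinant.
  borelize (Matrix (Fin n) (Fin n) L)
  let ν : Measure (Matrix (Fin n) (Fin n) L) := Measure.map e volume
  have hν : ν.IsAddHaarMeasure := e.isAddHaarMeasure_map volume
  have hec : Continuous e := e.continuous_toFun
  let δ : GL (Fin n) L →* ℝ≥0 :=
    { toFun := fun g => ‖LinearMap.det (Λ (e.symm g.val) : EuclideanSpace ℝ (Fin m) →ₗ[ℝ] _)‖₊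
      map_one' := by
        rw [Units.val_one, hΛone]
        simp
      map_mul' := fun g h => by
        rw [Units.val_mul, hΛmul, ContinuousLinearMap.toLinearMap_mul, map_mul, nnnorm_mul] }
  have hδ : Continuous δ := ((contDiff_det Λ).continuous.comp
    (e.symm.continuous_toFun.comp Units.continuous_val)).nnnorm
  have hdet : ∀ x, IsUnit (e x) →
      LinearMap.det (Λ x : EuclideanSpace ℝ (Fin m) →ₗ[ℝ] EuclideanSpace ℝ (Fin m)) ≠ 0 := by
    rintro x ⟨g, hg⟩
    have h0 : δ g ≠ 0 := fun h => by simpa [h] using map_mul δ g g⁻¹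
    simpa [δ, hg] using h0
  have hδν : ∀ g : GL (Fin n) L, δ g • ν.map (fun X => g.val * X) = ν := by
    intro g
    have h0 := hdet (e.symm g.val) (by simp [g.isUnit])
    have h1 : (fun X => g.val * X) ∘ e =
        e ∘ (Λ (e.symm g.val) : EuclideanSpace ℝ (Fin m) →ₗ[ℝ] EuclideanSpace ℝ (Fin m)) := by
      funext y
      simp [hΛ]
    rw [Measure.map_map (measurable_const_mul _) hec.measurable, h1,
      ← Measure.map_map hec.measurable
        (show Measurable ⇑(Λ (e.symm g.val) : EuclideanSpace ℝ (Fin m) →ₗ[ℝ] _) from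
          (Λ (e.symm g.val)).continuous.measurable),
      Measure.map_linearMap_addHaar_eq_smul_addHaar volume h0, Measure.map_smul, ENNReal.smul_def,
      smul_smul]
    have h2 : (δ g : ℝ≥0∞) = ENNReal.ofReal |LinearMap.det
        (Λ (e.symm g.val) : EuclideanSpace ℝ (Fin m) →ₗ[ℝ] EuclideanSpace ℝ (Fin m))| :=
      (Real.enorm_eq_ofReal_abs _)
    rw [h2, ← ENNReal.ofReal_mul (abs_nonneg _), ← abs_mul, mul_inv_cancel₀ h0]
    simp [ν]
  obtain ⟨c, hc⟩ := exists_lam_eq ν δ hδ hδν μ hf.continuous (continuous_of_contDiffOn e hφ) hφ'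
  -- The amplitude, which is smooth because inversion, transposition and determinants are.
  let ψ : EuclideanSpace ℝ (Fin m) → ℂ := fun x => matrixAmplitude δ φ (e x)
  obtain ⟨S, hS, hSu, hS0⟩ := exists_isCompact_matrixAmplitude δ hφ'
  have hS' : IsCompact (e ⁻¹' S) := e.toHomeomorph.isClosedEmbedding.isCompact_preimage hS
  have hsub : tsupport ψ ⊆ e ⁻¹' S :=
    closure_minimal (fun x hx => by_contra fun h => hx (hS0 _ h)) hS'.isClosed
  have hopen : IsOpen {x | IsUnit (e x)} :=
    (isOpenEmbedding_val_GL (L := L) (n := n)).isOpen_range.preimage hec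
  obtain ⟨T, hT⟩ : ∃ T : EuclideanSpace ℝ (Fin m) →L[ℝ] EuclideanSpace ℝ (Fin m),
      ∀ x, T x = e.symm (e x)ᵀ :=
    ⟨(AddMonoidHom.mk' (fun x => e.symm (e x)ᵀ) fun x y => by simp).toRealLinearMap
      (e.symm.continuous_toFun.comp hec.matrix_transpose), fun _ => rfl⟩
  have hψ : ContDiffOn ℝ ∞ ψ {x | IsUnit (e x)} := by
    let σ : EuclideanSpace ℝ (Fin m) → EuclideanSpace ℝ (Fin m) :=
      fun x => T (Ring.inverse (Λ x) (e.symm 1))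
    have hσ : ∀ x (g : GL (Fin n) L), g.val = e x → e (σ x) = (invTranspose g).val := by
      intro x g hg
      have h1 : e.symm 1 = Λ x (e.symm (g⁻¹).val) := by simp [hΛ, ← hg]
      simp only [σ]
      rw [h1]
      have h2 := congr($(Ring.inverse_mul_cancel _ (hΛunit x ⟨g, hg⟩)) (e.symm (g⁻¹).val))
      rw [mul_apply_eq_comp] at h2
      rw [h2, hT]
      change e (e.symm (e (e.symm (g⁻¹).val))ᵀ) = _
      rw [e.apply_symm_apply, e.apply_symm_apply]
      rfl
    have hσs : ContDiffOn ℝ ∞ σ {x | IsUnit (e x)} := by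
      intro x hx
      obtain ⟨u, hu⟩ := hΛunit x hx
      have h1 : ContDiffAt ℝ ∞ (fun x => Ring.inverse (Λ x)) x :=
        ContDiffAt.comp (g := Ring.inverse) x (by rw [← hu]; exact contDiffAt_ringInverse ℝ u)
          Λ.contDiff.contDiffAt
      exact (T.contDiff.contDiffAt.comp x (h1.clm_apply contDiffAt_const)).contDiffWithinAt
    have h2 : ContDiffOn ℝ ∞ (fun x => ((|LinearMap.det (Λ x : EuclideanSpace ℝ (Fin m) →ₗ[ℝ]
        EuclideanSpace ℝ (Fin m))|⁻¹ : ℝ) : ℂ)) {x | IsUnit (e x)} := by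
      intro x hx
      have h3 : ContDiffAt ℝ ∞ (fun x => |LinearMap.det (Λ x : EuclideanSpace ℝ (Fin m) →ₗ[ℝ]
          EuclideanSpace ℝ (Fin m))|) x :=
        ContDiffAt.comp (g := fun t : ℝ => |t|) x (contDiffAt_abs (hdet x hx))
          (contDiff_det Λ).contDiffAt
      exact (Complex.ofRealCLM.contDiff.contDiffAt.comp x
        (h3.inv (abs_ne_zero.2 (hdet x hx)))).contDiffWithinAt
    refine (h2.mul (hφ.comp hσs ?_)).congr ?_
    · rintro x ⟨g, hg⟩
      exact ⟨invTranspose g, (hσ x g hg).symm⟩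
    · rintro x ⟨g, hg⟩
      simp only [ψ, Function.comp_def]
      rw [hσ x g hg, ← hg, matrixAmplitude_val,
        Function.Injective.extend_apply Units.val_injective φ 0 (invTranspose g), NNReal.smul_def,
        Complex.real_smul]
      simp [δ, hg]
  have hamp : IsAmplitude ρ ψ :=
    ⟨contDiff_of_contDiffOn_of_tsupport_subset hopen hψ (hsub.trans fun x hx => hSu _ hx),
      HasCompactSupport.of_support_subset_isCompact hS' (subset_closure.trans hsub),
      fun x hx => hρunit x (hSu _ (hsub hx))⟩
  obtain ⟨g, hg⟩ := exists_schwartzMap_eq_osc volume hF hBnd hρsurj hamp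
  refine Or.inl ⟨d, eV, c • g, fun v => ?_⟩
  rw [hc, _root_.smul_apply, hg, smul_eq_mul, osc]
  congr 1
  refine (e.toHomeomorph.measurableEmbedding.integral_map _).trans ?_
  refine integral_congr_ae (.of_forall fun x => ?_)
  simp only [hρ, ContinuousAddEquiv.apply_symm_apply, smul_eq_mul, ψ]
  exact mul_comm _ _

end Archimedean

/-! ### Totally disconnected locally compact groups and fields -/

section TotallyDisconnected

section Group

variable {G : Type*} [AddCommGroup G] [TopologicalSpace G] [IsTopologicalAddGroup G]

/-- Van Dantzig's theorem for commutative groups: in a compact open neighbourhood `C` of `0`, the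
translations that preserve `C` form an open subgroup. -/
lemma exists_addSubgroup_subset [LocallyCompactSpace G] [T2Space G] [TotallyDisconnectedSpace G]
    {U : Set G} (hU : U ∈ 𝓝 (0 : G)) :
    ∃ H : AddSubgroup G, IsOpen (H : Set G) ∧ IsCompact (H : Set G) ∧ (H : Set G) ⊆ U := by
  obtain ⟨K, hK, hKU, hKc⟩ := local_compact_nhds hU
  obtain ⟨C, hC, h0C, hCK⟩ := loc_compact_Haus_tot_disc_of_zero_dim.mem_nhds_iff.1 hK
  have hCc : IsCompact C := hKc.of_isClosed_subset hC.isClosed hCK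
  let H : AddSubgroup G :=
    { carrier := {x | ∀ c ∈ C, x + c ∈ C ∧ -x + c ∈ C}
      zero_mem' := fun c hc => by simpa using hc
      add_mem' := fun {x y} hx hy c hc => by
        refine ⟨?_, ?_⟩
        · rw [add_assoc]; exact (hx _ (hy c hc).1).1
        · rw [neg_add, add_assoc]; exact (hx _ (hy c hc).2).2
      neg_mem' := fun {x} hx c hc => by
        rw [neg_neg]; exact ⟨(hx c hc).2, (hx c hc).1⟩ }
  have h1 : ∀ᶠ x in 𝓝 (0 : G), ∀ c ∈ C, x + c ∈ C := by
    refine hCc.eventually_forall_of_forall_eventually fun c hc => ?_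
    exact (continuous_fst.add continuous_snd).continuousAt.eventually
      (hC.isOpen.mem_nhds (by simpa using hc))
  have h2 : ∀ᶠ x in 𝓝 (0 : G), ∀ c ∈ C, -x + c ∈ C :=
    (continuous_neg.tendsto' (0 : G) 0 neg_zero).eventually h1
  have hHopen : IsOpen (H : Set G) := H.isOpen_of_mem_nhds (g := 0) <| by
    filter_upwards [h1, h2] with x hx hx' c hc using ⟨hx c hc, hx' c hc⟩
  have hHC : (H : Set G) ⊆ C := fun x hx => by simpa using (hx 0 h0C).1
  exact ⟨H, hHopen, hCc.of_isClosed_subset (H.isClosed_of_isOpen hHopen) hHC,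
    (hHC.trans hCK).trans hKU⟩

/-- The circle has no small subgroups. -/
lemma circle_eq_one_of_norm_pow_sub_one_le {z : Circle}
    (hz : ∀ k : ℕ, ‖((z ^ k : Circle) : ℂ) - 1‖ ≤ 1 / 2) : z = 1 := by
  by_contra hne
  have hpos : 0 < ‖(z : ℂ) - 1‖ := by
    rw [norm_pos_iff, sub_ne_zero]
    exact fun h => hne (Circle.ext h)
  -- Squaring an element close to `1` multiplies its distance to `1` by at least `3 / 2`.
  have hgrow : ∀ k : ℕ, (3 / 2 : ℝ) ^ k * ‖(z : ℂ) - 1‖ ≤ ‖((z ^ 2 ^ k : Circle) : ℂ) - 1‖ := by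
    intro k
    induction k with
    | zero => simp
    | succ k ih =>
      set w : ℂ := ((z ^ 2 ^ k : Circle) : ℂ) with hw
      have h1 : ((z ^ 2 ^ (k + 1) : Circle) : ℂ) - 1 = (w + 1) * (w - 1) := by
        rw [pow_succ, pow_mul, Circle.coe_pow, ← hw]
        ring
      have h2 : (3 / 2 : ℝ) ≤ ‖w + 1‖ := by
        have h3 : ‖(2 : ℂ)‖ ≤ ‖w + 1‖ + ‖w - 1‖ := by
          rw [show (2 : ℂ) = (w + 1) - (w - 1) by ring]
          exact norm_sub_le _ _
        have h4 := hz (2 ^ k)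
        rw [← hw] at h4
        norm_num at h3
        linarith
      rw [h1, norm_mul, pow_succ, mul_comm _ (3 / 2 : ℝ), mul_assoc]
      exact mul_le_mul h2 ih (by positivity) (by positivity)
  obtain ⟨k, hk⟩ := pow_unbounded_of_one_lt (1 / 2 / ‖(z : ℂ) - 1‖)
    (show (1 : ℝ) < 3 / 2 by norm_num)
  rw [div_lt_iff₀ hpos] at hk
  exact absurd (hz (2 ^ k)) (not_le.2 (hk.trans_le (hgrow k)))

lemma eq_one_of_mem_addSubgroup {χ : G → Circle} {H : AddSubgroup G}
    (hχ : ∀ x ∈ H, ∀ y ∈ H, χ (x + y) = χ x * χ y)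
    (hsmall : ∀ x ∈ H, ‖(χ x : ℂ) - 1‖ ≤ 1 / 2) {x : G} (hx : x ∈ H) : χ x = 1 := by
  have h0 : χ 0 = 1 := by simpa using hχ 0 H.zero_mem 0 H.zero_mem
  have hpow : ∀ k : ℕ, χ (k • x) = χ x ^ k := by
    intro k
    induction k with
    | zero => simp [h0]
    | succ k ih => rw [succ_nsmul, hχ _ (H.nsmul_mem hx k) _ hx, ih, pow_succ]
  exact circle_eq_one_of_norm_pow_sub_one_le fun k => by
    rw [← hpow]; exact hsmall _ (H.nsmul_mem hx k)

lemma eventually_norm_circle_sub_one_le {X : Type*} [TopologicalSpace X] {χ : X → Circle}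
    (hχ : Continuous χ) {x : X} (hx : χ x = 1) :
    ∀ᶠ y in 𝓝 x, ‖(χ y : ℂ) - 1‖ ≤ 1 / 2 := by
  have hc : Continuous fun y => ‖(χ y : ℂ) - 1‖ :=
    ((continuous_circle_coe.comp hχ).sub continuous_const).norm
  filter_upwards [hc.continuousAt.eventually_lt_const (show ‖(χ x : ℂ) - 1‖ < 1 / 2 by simp [hx])]
    with y hy using hy.le

variable {f : G → Circle}

lemma IsSecondDegreeCharacter.continuous_polar (hf : IsSecondDegreeCharacter f) :
    Continuous fun p : G × G => polar f p.1 p.2 := by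
  have := hf.continuous
  unfold polar
  fun_prop

lemma IsSecondDegreeCharacter.continuous_polar_comp (hf : IsSecondDegreeCharacter f)
    {T : Type*} [TopologicalSpace T] {a b : T → G} (ha : Continuous a) (hb : Continuous b) :
    Continuous fun t => polar f (a t) (b t) :=
  hf.continuous_polar.comp (ha.prodMk hb)

variable [LocallyCompactSpace G] [T2Space G] [TotallyDisconnectedSpace G]

/-- On a small compact open subgroup the polarization is trivial, since the circle has no small
subgroups; so `f` is a character there, and trivial for the same reason. -/
lemma IsSecondDegreeCharacter.exists_addSubgroup_eq_one (hf : IsSecondDegreeCharacter f) :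
    ∃ K : AddSubgroup G, IsOpen (K : Set G) ∧ ∀ k ∈ K, f k = 1 := by
  have h1 := eventually_norm_circle_sub_one_le hf.continuous_polar (x := ((0, 0) : G × G))
    (hf.polar_zero_left 0)
  rw [nhds_prod_eq] at h1
  obtain ⟨U, hU, hU'⟩ := (eventually_prod_self_iff
    (r := fun x y => ‖(polar f x y : ℂ) - 1‖ ≤ 1 / 2)).1 h1
  obtain ⟨K, hKo, -, hK⟩ := exists_addSubgroup_subset
    (inter_mem hU (eventually_norm_circle_sub_one_le hf.continuous hf.map_zero))
  refine ⟨K, hKo, fun k hk => ?_⟩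
  have hpolar : ∀ x ∈ K, ∀ y ∈ K, polar f x y = 1 := fun x hx y hy =>
    eq_one_of_mem_addSubgroup (χ := polar f x) (fun y _ y' _ => hf.polar_add_right x y y')
      (fun y hy => hU' x (hK hx).1 y (hK hy).1) hy
  exact eq_one_of_mem_addSubgroup (χ := f)
    (fun x hx y hy => by rw [map_add_eq f x y, hpolar x hx y hy, mul_one])
    (fun x hx => (hK hx).2) hk

/-- Second degree characters of totally disconnected groups are locally constant. -/
lemma IsSecondDegreeCharacter.eventually_eq (hf : IsSecondDegreeCharacter f) (x : G) :
    ∀ᶠ y in 𝓝 x, f y = f x := by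
  obtain ⟨K, hKo, hK⟩ := hf.exists_addSubgroup_eq_one
  have h1 : ∀ᶠ y in 𝓝 (0 : G), ‖(polar f x y : ℂ) - 1‖ ≤ 1 / 2 :=
    eventually_norm_circle_sub_one_le
      (hf.continuous_polar.comp (continuous_const.prodMk continuous_id))
      (by simp [polar_comm f x, hf.polar_zero_left])
  obtain ⟨K', hKo', -, hK'⟩ := exists_addSubgroup_subset h1
  have h2 : Tendsto (fun y => y - x) (𝓝 x) (𝓝 0) :=
    (continuous_sub_right x).tendsto' _ _ (sub_self x)
  filter_upwards [h2.eventually (hKo.mem_nhds K.zero_mem),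
    h2.eventually (hKo'.mem_nhds K'.zero_mem)] with y hy hy'
  have h3 : polar f x (y - x) = 1 :=
    eq_one_of_mem_addSubgroup (χ := polar f x) (fun y _ y' _ => hf.polar_add_right x y y')
      (fun y hy => hK' hy) hy'
  have h4 := map_add_eq f x (y - x)
  rwa [h3, hK _ hy, add_sub_cancel, mul_one, mul_one] at h4

end Group

section Field

variable {L : Type*} [Field L] [TopologicalSpace L] [IsTopologicalDivisionRing L] [T2Space L]
  [LocallyCompactSpace L] [TotallyDisconnectedSpace L]

/-- A non-discrete totally disconnected locally compact field has a compact open subring: the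
multipliers of a compact open subgroup. -/
lemma exists_compact_open_subring (hL : ¬ DiscreteTopology L) :
    ∃ O : Subring L, IsOpen (O : Set L) ∧ IsCompact (O : Set L) := by
  obtain ⟨H, hHo, hHc, -⟩ := exists_addSubgroup_subset (G := L) univ_mem
  obtain ⟨a, haH, ha⟩ : ∃ a ∈ H, a ≠ 0 := by
    by_contra! h
    refine hL (discreteTopology_of_isOpen_singleton_zero ?_)
    rwa [show ({0} : Set L) = H from
      Set.Subset.antisymm (Set.singleton_subset_iff.2 H.zero_mem) fun x hx => h x hx]
  let O : Subring L :=
    { carrier := {x | ∀ y ∈ H, x * y ∈ H}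
      one_mem' := fun y hy => by simpa using hy
      zero_mem' := fun y _ => by simp
      mul_mem' := fun {x x'} hx hx' y hy => by rw [mul_assoc]; exact hx _ (hx' y hy)
      add_mem' := fun {x x'} hx hx' y hy => by rw [add_mul]; exact H.add_mem (hx y hy) (hx' y hy)
      neg_mem' := fun {x} hx y hy => by rw [neg_mul]; exact H.neg_mem (hx y hy) }
  have hOo : IsOpen (O : Set L) := O.toAddSubgroup.isOpen_of_mem_nhds (g := 0) <| by
    refine hHc.eventually_forall_of_forall_eventually (P := fun x y => x * y ∈ H) fun y _ => ?_
    exact (continuous_fst.mul continuous_snd).continuousAt.eventually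
      (hHo.mem_nhds (by simp))
  refine ⟨O, hOo, (hHc.image (continuous_mul_const a⁻¹)).of_isClosed_subset
    (O.toAddSubgroup.isClosed_of_isOpen hOo) fun x hx => ?_⟩
  exact ⟨x * a, hx a haH, mul_inv_cancel_right₀ ha x⟩

/-- Some positive integer is topologically nilpotent. The integer is the index of an open subgroup
of a compact open subring `O` that does not contain `1`, so that its inverse is not in `O`; a
nonzero cluster point of its powers would bring a negative power into `O`. -/
lemma exists_nat_tendsto_pow_zero [CharZero L] (hL : ¬ DiscreteTopology L) :
    ∃ N : ℕ, (N : L) ≠ 0 ∧ Tendsto (fun r : ℕ => (N : L) ^ r) atTop (𝓝 0) := by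
  obtain ⟨O, hOo, hOc⟩ := exists_compact_open_subring hL
  obtain ⟨H, hHo, -, hH⟩ := exists_addSubgroup_subset (G := L) (U := {1}ᶜ)
    (isOpen_compl_singleton.mem_nhds (by simp))
  have : CompactSpace O.toAddSubgroup := isCompact_iff_compactSpace.1 hOc
  let H' : AddSubgroup O.toAddSubgroup := H.addSubgroupOf O.toAddSubgroup
  have hH'o : IsOpen (H' : Set O.toAddSubgroup) := hHo.preimage continuous_subtype_val
  have hfin : Finite (O.toAddSubgroup ⧸ H') := H'.quotient_finite_of_isOpen hH'o
  have hN0 : H'.index ≠ 0 := AddSubgroup.index_ne_zero_of_finite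
  have hNL : (H'.index : L) ≠ 0 := Nat.cast_ne_zero.2 hN0
  have hNinv : (H'.index : L)⁻¹ ∉ O := by
    intro h
    have h1 : H'.index • (⟨(H'.index : L)⁻¹, h⟩ : O.toAddSubgroup) ∈ H' :=
      H'.nsmul_index_mem _
    have h2 : H'.index • (H'.index : L)⁻¹ ∈ H := h1
    rw [nsmul_eq_mul, mul_inv_cancel₀ hNL] at h2
    exact hH h2 rfl
  refine ⟨H'.index, hNL, ?_⟩
  generalize H'.index = N at *
  have hNO : ∀ r : ℕ, (N : L) ^ r ∈ O := fun r => pow_mem (natCast_mem O N) r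
  refine hOc.tendsto_nhds_of_unique_mapClusterPt (.of_forall hNO) fun c _ hc => ?_
  by_contra hc0
  have hcl : MapClusterPt c⁻¹ atTop fun r : ℕ => ((N : L) ^ r)⁻¹ :=
    hc.continuousAt_comp (continuousAt_inv₀ hc0)
  have hfreq : ∃ᶠ r in atTop, ((N : L) ^ r)⁻¹ - c⁻¹ ∈ O := by
    refine hcl.frequently (p := fun y => y - c⁻¹ ∈ O) ?_
    exact (continuous_sub_right c⁻¹).continuousAt.eventually (hOo.mem_nhds (by simp))
  rw [frequently_atTop] at hfreq
  obtain ⟨r, -, hr⟩ := hfreq 0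
  obtain ⟨s, hrs, hs⟩ := hfreq (r + 1)
  obtain ⟨k, rfl⟩ := Nat.exists_eq_add_of_le hrs
  have h1 : ((N : L) ^ (r + 1 + k))⁻¹ - ((N : L) ^ r)⁻¹ ∈ O := by
    simpa using O.sub_mem hs hr
  have h2 := O.mul_mem (hNO (r + k)) h1
  have h3 : (N : L) ^ (r + k) * (((N : L) ^ (r + 1 + k))⁻¹ - ((N : L) ^ r)⁻¹) =
      (N : L)⁻¹ - (N : L) ^ k := by
    field_simp
    ring
  rw [h3] at h2
  exact hNinv (by simpa using O.add_mem h2 (hNO k))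

end Field

end TotallyDisconnected

/-! ### The non-archimedean case -/

section Vanishing

variable {A : Type*} [AddCommGroup A] [TopologicalSpace A] [IsTopologicalAddGroup A]
  [MeasurableSpace A] [BorelSpace A]

/-- If translations by a compact open subgroup `G` multiply a function by characters of `G` that
are nontrivial wherever the function does not vanish, then its integral is zero. -/
lemma integral_eq_zero_of_character (ν : Measure A) [ν.IsAddHaarMeasure] {Φ : A → ℂ}
    (hΦ : Continuous Φ) (hΦ' : HasCompactSupport Φ) {G : AddSubgroup A} (hGo : IsOpen (G : Set A))
    (hGc : IsCompact (G : Set A)) (χ : A → A → Circle)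
    (hχ : ∀ x y y', χ x (y + y') = χ x y * χ x y')
    (hmul : ∀ x, ∀ y ∈ G, Φ (x + y) = Φ x * (χ x y : ℂ))
    (hnt : ∀ x, Φ x ≠ 0 → ∃ y ∈ G, χ x y ≠ 1) : ∫ x, Φ x ∂ν = 0 := by
  have hGcl : IsClosed (G : Set A) := G.isClosed_of_isOpen hGo
  let F : A → A → ℂ := fun x y => Φ (x + y) * (G : Set A).indicator (fun _ => (1 : ℂ)) y
  have hind : Continuous ((G : Set A).indicator fun _ => (1 : ℂ)) :=
    continuous_const.indicator (by simp [IsClopen.frontier_eq ⟨hGcl, hGo⟩])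
  have hF : Continuous F.uncurry := by
    change Continuous fun p : A × A => Φ (p.1 + p.2) * (G : Set A).indicator (fun _ => (1 : ℂ)) p.2
    exact (hΦ.comp (continuous_fst.add continuous_snd)).mul (hind.comp continuous_snd)
  have hF' : HasCompactSupport F.uncurry := by
    -- The support lies in the image of `tsupport Φ × G` under the shear `(z, y) ↦ (z - y, y)`.
    refine HasCompactSupport.intro' (K := (fun p : A × A => (p.1 + p.2, p.2)) ⁻¹'
      (tsupport Φ ×ˢ (G : Set A))) ?_ ?_ ?_
    · let e : A × A ≃ₜ A × A :=
        { toFun := fun p => (p.1 + p.2, p.2)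
          invFun := fun p => (p.1 - p.2, p.2)
          left_inv := fun p => by simp
          right_inv := fun p => by simp }
      exact e.isClosedEmbedding.isCompact_preimage (hΦ'.isCompact.prod hGc)
    · exact ((isClosed_tsupport Φ).prod hGcl).preimage (by fun_prop)
    · rintro ⟨x, y⟩ hxy
      by_cases hy : y ∈ G
      · have : Φ (x + y) = 0 := by
          by_contra h
          exact hxy ⟨subset_tsupport _ h, hy⟩
        simp [F, this]
      · simp [F, Set.indicator_of_notMem (show y ∉ (G : Set A) from hy)]
  have hswap := integral_integral_swap_of_hasCompactSupport hF hF' (μ := ν) (ν := ν)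
  have hleft : ∀ x, ∫ y, F x y ∂ν = 0 := by
    intro x
    by_cases hx : Φ x = 0
    · have : ∀ y, F x y = 0 := by
        intro y
        by_cases hy : y ∈ G
        · simp [F, hmul x y hy, hx]
        · simp [F, Set.indicator_of_notMem (show y ∉ (G : Set A) from hy)]
      simp [this]
    · obtain ⟨y₀, hy₀, hne⟩ := hnt x hx
      have htrans : ∀ y, F x (y₀ + y) = (χ x y₀ : ℂ) * F x y := by
        intro y
        by_cases hy : y ∈ G
        · have h1 : y₀ + y ∈ (G : Set A) := G.add_mem hy₀ hy
          simp only [F, hmul x y hy, hmul x _ h1, hχ, Set.indicator_of_mem h1,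
            Set.indicator_of_mem (show y ∈ (G : Set A) from hy), Circle.coe_mul]
          ring
        · have h1 : y₀ + y ∉ (G : Set A) := fun h => hy ((G.add_mem_cancel_left hy₀).1 h)
          simp [F, Set.indicator_of_notMem h1,
            Set.indicator_of_notMem (show y ∉ (G : Set A) from hy)]
      have h2 : ∫ y, F x y ∂ν = (χ x y₀ : ℂ) * ∫ y, F x y ∂ν := by
        rw [← integral_const_mul, ← integral_add_left_eq_self (μ := ν) (F x) y₀]
        exact integral_congr_ae (.of_forall htrans)
      have h3 : ((χ x y₀ : ℂ) - 1) * ∫ y, F x y ∂ν = 0 := by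
        rw [sub_mul, one_mul, ← h2, sub_self]
      refine (mul_eq_zero.1 h3).resolve_left ?_
      exact fun h => hne (Circle.ext (sub_eq_zero.1 h))
  have hright : ∫ y, ∫ x, F x y ∂ν ∂ν = (∫ x, Φ x ∂ν) * (ν.real G : ℂ) := by
    have : ∀ y, ∫ x, F x y ∂ν = (∫ x, Φ x ∂ν) * (G : Set A).indicator (fun _ => (1 : ℂ)) y := by
      intro y
      simp only [F]
      rw [integral_mul_const, integral_add_right_eq_self (μ := ν) Φ y]
    simp_rw [this]
    rw [integral_const_mul, integral_indicator hGo.measurableSet]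
    simp
  simp only [hleft, integral_zero] at hswap
  rw [hright] at hswap
  have hpos : (ν.real G : ℂ) ≠ 0 := by
    rw [Complex.ofReal_ne_zero, measureReal_def, ENNReal.toReal_ne_zero]
    exact ⟨hGo.measure_ne_zero ν ⟨0, G.zero_mem⟩, hGc.measure_lt_top.ne⟩
  exact (mul_eq_zero.1 hswap.symm).resolve_right hpos

end Vanishing

section Nonarchimedean

open Matrix

variable {L : Type*} [Field L] [TopologicalSpace L] [IsTopologicalDivisionRing L] [T2Space L]
  [LocallyCompactSpace L] {n : ℕ}

instance : LocallyCompactSpace (Matrix (Fin n) (Fin n) L) :=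
  inferInstanceAs (LocallyCompactSpace (Fin n → Fin n → L))

instance [TotallyDisconnectedSpace L] : TotallyDisconnectedSpace (Matrix (Fin n) (Fin n) L) :=
  inferInstanceAs (TotallyDisconnectedSpace (Fin n → Fin n → L))

/-- Left multiplication by an invertible matrix, as an automorphism of the additive group. -/
def mulLeftEquiv (g : GL (Fin n) L) : Matrix (Fin n) (Fin n) L ≃ₜ+ Matrix (Fin n) (Fin n) L where
  toFun X := g.val * X
  invFun X := (g⁻¹).val * X
  left_inv X := Units.inv_mul_cancel_left g X
  right_inv X := Units.mul_inv_cancel_left g X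
  map_add' := mul_add _
  continuous_toFun := continuous_const.mul continuous_id
  continuous_invFun := continuous_const.mul continuous_id

/-- The factor by which left multiplication by an invertible matrix scales the additive Haar
measure of `M_n(L)`. -/
def modulus [MeasurableSpace (Matrix (Fin n) (Fin n) L)] [BorelSpace (Matrix (Fin n) (Fin n) L)] :
    GL (Fin n) L →* ℝ≥0 where
  toFun g := addEquivAddHaarChar (mulLeftEquiv g)
  map_one' := by
    rw [show mulLeftEquiv (1 : GL (Fin n) L) = ContinuousAddEquiv.refl _ from
      ContinuousAddEquiv.ext fun X => one_mul X]
    exact addEquivAddHaarChar_refl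
  map_mul' g h := by
    rw [show mulLeftEquiv (g * h) = (mulLeftEquiv h).trans (mulLeftEquiv g) from
      ContinuousAddEquiv.ext fun X => mul_assoc g.val h.val X]
    exact (addEquivAddHaarChar_trans (φ := mulLeftEquiv g) (ψ := mulLeftEquiv h)).trans
      (mul_comm _ _)

variable [TotallyDisconnectedSpace L]

/-- The modulus is locally constant, because it is `1` on the stabilizer of a compact open subgroup
of `M_n(L)`. -/
lemma isLocallyConstant_modulus [MeasurableSpace (Matrix (Fin n) (Fin n) L)]
    [BorelSpace (Matrix (Fin n) (Fin n) L)] :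
    IsLocallyConstant (modulus : GL (Fin n) L →* ℝ≥0) := by
  obtain ⟨G, hGo, hGc, -⟩ := exists_addSubgroup_subset (G := Matrix (Fin n) (Fin n) L) univ_mem
  have h1 : ∀ᶠ g in 𝓝 (1 : GL (Fin n) L), ∀ X ∈ (G : Set (Matrix (Fin n) (Fin n) L)),
      g.val * X ∈ G := by
    refine hGc.eventually_forall_of_forall_eventually
      (P := fun (g : GL (Fin n) L) X => g.val * X ∈ G) fun X hX => ?_
    exact ((Units.continuous_val.comp continuous_fst).mul continuous_snd).continuousAt.eventually
      (hGo.mem_nhds (by simpa using hX))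
  have h2 : ∀ᶠ g in 𝓝 (1 : GL (Fin n) L), ∀ X ∈ (G : Set (Matrix (Fin n) (Fin n) L)),
      (g⁻¹).val * X ∈ G := (continuous_inv.tendsto' (1 : GL (Fin n) L) 1 inv_one).eventually h1
  have h3 : ∀ᶠ g in 𝓝 (1 : GL (Fin n) L), modulus g = 1 := by
    filter_upwards [h1, h2] with g hg hg'
    have hpre : mulLeftEquiv g ⁻¹' (G : Set (Matrix (Fin n) (Fin n) L)) = G := by
      ext X
      refine ⟨fun h => ?_, fun h => hg X h⟩
      have := hg' _ h
      change (g⁻¹).val * (g.val * X) ∈ G at this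
      rwa [Units.inv_mul_cancel_left] at this
    have h := addEquivAddHaarChar_smul_preimage Measure.addHaar
      (X := (G : Set (Matrix (Fin n) (Fin n) L))) (mulLeftEquiv g)
    rw [hpre, ENNReal.smul_def, smul_eq_mul] at h
    have h0 : (Measure.addHaar : Measure (Matrix (Fin n) (Fin n) L)) G ≠ 0 :=
      hGo.measure_ne_zero _ ⟨0, G.zero_mem⟩
    have h4 := (ENNReal.mul_eq_right h0 hGc.measure_lt_top.ne).1 h
    exact_mod_cast h4
  refine (IsLocallyConstant.iff_eventually_eq _).2 fun g => ?_
  have h5 : Tendsto (fun x => g⁻¹ * x) (𝓝 g) (𝓝 1) :=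
    (continuous_const_mul g⁻¹).tendsto' _ _ (inv_mul_cancel g)
  filter_upwards [h5.eventually h3] with x hx
  rw [← mul_inv_cancel_left g x, map_mul, hx, mul_one]

/-- The amplitude is invariant under translation by some open subgroup of `M_n(L)`. -/
lemma exists_addSubgroup_matrixAmplitude_add {δ : GL (Fin n) L →* ℝ≥0} (hδ : IsLocallyConstant δ)
    {φ : GL (Fin n) L → ℂ} (hφ : IsLocallyConstant φ) (hφ' : HasCompactSupport φ) :
    ∃ G : AddSubgroup (Matrix (Fin n) (Fin n) L), IsOpen (G : Set (Matrix (Fin n) (Fin n) L)) ∧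
      IsCompact (G : Set (Matrix (Fin n) (Fin n) L)) ∧
      ∀ X, ∀ Y ∈ G, matrixAmplitude δ φ (X + Y) = matrixAmplitude δ φ X := by
  obtain ⟨S, hS, hSu, hS0⟩ := exists_isCompact_matrixAmplitude δ hφ'
  have hloc : ∀ X ∈ S, ∀ᶠ X' in 𝓝 X, matrixAmplitude δ φ X' = matrixAmplitude δ φ X := by
    intro X hX
    obtain ⟨g, rfl⟩ := hSu X hX
    rw [← isOpenEmbedding_val_GL.map_nhds_eq, eventually_map]
    filter_upwards [hδ.eventually_eq g,
      (invTranspose (L := L) (n := n)).continuous_toFun.continuousAt.eventually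
        (hφ.eventually_eq (invTranspose g))] with g' h1 h2
    rw [matrixAmplitude_val, matrixAmplitude_val, h1]
    exact congrArg _ h2
  have h1 : ∀ᶠ Y in 𝓝 (0 : Matrix (Fin n) (Fin n) L), ∀ X ∈ S,
      matrixAmplitude δ φ (X + Y) = matrixAmplitude δ φ X := by
    refine hS.eventually_forall_of_forall_eventually
      (P := fun Y X => matrixAmplitude δ φ (X + Y) = matrixAmplitude δ φ X) fun X hX => ?_
    have h2 : Tendsto (fun p : Matrix (Fin n) (Fin n) L × Matrix (Fin n) (Fin n) L => p.2 + p.1)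
        (𝓝 (0, X)) (𝓝 X) :=
      (continuous_snd.add continuous_fst).tendsto' _ _ (by simp)
    filter_upwards [h2.eventually (hloc X hX),
      (continuous_snd.tendsto' ((0 : Matrix (Fin n) (Fin n) L), X) X rfl).eventually (hloc X hX)]
      with p hp hp'
    rw [hp, hp']
  obtain ⟨G, hGo, hGc, hG⟩ := exists_addSubgroup_subset h1
  refine ⟨G, hGo, hGc, fun X Y hY => ?_⟩
  by_cases hX : X ∈ S
  · exact hG hY X hX
  by_cases hXY : X + Y ∈ S
  · have := hG (G.neg_mem hY) (X + Y) hXY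
    rw [add_neg_cancel_right] at this
    exact this.symm
  · rw [hS0 _ hX, hS0 _ hXY]

variable {f : (Fin n → L) → Circle}

lemma IsSecondDegreeCharacter.polar_nsmul_left {V : Type*} [AddCommGroup V] [TopologicalSpace V]
    {f : V → Circle} (hf : IsSecondDegreeCharacter f) (N : ℕ) (x y : V) :
    polar f (N • x) y = polar f x y ^ N := by
  induction N with
  | zero => simp [hf.polar_zero_left]
  | succ N ih => rw [succ_nsmul, hf.polar_add_left, ih, pow_succ]

lemma IsSecondDegreeCharacter.polar_nsmul_comm {V : Type*} [AddCommGroup V] [TopologicalSpace V]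
    {f : V → Circle} (hf : IsSecondDegreeCharacter f) (N : ℕ) (x y : V) :
    polar f (N • x) y = polar f x (N • y) := by
  rw [polar_comm f x, hf.polar_nsmul_left, hf.polar_nsmul_left, polar_comm]

/-- Every vector outside a compact set is `N⁻ʳ u` with `r` large and `u` in a fixed compact set
of nonzero vectors, for a topologically nilpotent integer `N`. -/
lemma exists_compact_fundamental_domain {N : ℕ} (hN0 : (N : L) ≠ 0)
    (hN : Tendsto (fun r : ℕ => (N : L) ^ r) atTop (𝓝 0)) :
    ∃ Q : Set (Fin n → L), IsCompact Q ∧ 0 ∉ Q ∧ ∀ J : ℕ, ∃ C : Set (Fin n → L), IsCompact C ∧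
      ∀ v ∉ C, ∃ r ≥ J, (N : L) ^ r • v ∈ Q := by
  obtain ⟨H, hHo, hHc, -⟩ := exists_addSubgroup_subset (G := Fin n → L) univ_mem
  have hHmul : ∀ k : ℕ, ∀ v ∈ H, (N : L) ^ k • v ∈ H := by
    intro k v hv
    rw [← Nat.cast_pow, Nat.cast_smul_eq_nsmul]
    exact H.nsmul_mem hv _
  have hcont : ∀ a : L, Continuous fun v : Fin n → L => a • v := fun a => continuous_const_smul a
  refine ⟨(H : Set (Fin n → L)) ∩ (fun v => (N : L)⁻¹ • v) ⁻¹' (H : Set (Fin n → L))ᶜ,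
    hHc.inter_right (hHo.isClosed_compl.preimage (hcont _)), fun h => h.2 (by simp), fun J => ?_⟩
  refine ⟨(fun v => (N : L) ^ J • v) ⁻¹' (H : Set (Fin n → L)),
    (Homeomorph.smulOfNeZero ((N : L) ^ J) (pow_ne_zero J hN0)).isClosedEmbedding.isCompact_preimage
      hHc, fun v hv => ?_⟩
  have hex : ∃ r : ℕ, (N : L) ^ r • v ∈ H := by
    have h1 : Tendsto (fun r : ℕ => (N : L) ^ r • v) atTop (𝓝 0) := by
      simpa using hN.smul_const v
    exact (h1.eventually (hHo.mem_nhds H.zero_mem)).exists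
  classical
  have hlt : J < Nat.find hex := by
    by_contra! hle
    obtain ⟨k, hk⟩ := Nat.exists_eq_add_of_le hle
    refine hv ?_
    have := hHmul k _ (Nat.find_spec hex)
    rw [smul_smul, ← pow_add, add_comm, ← hk] at this
    exact this
  refine ⟨Nat.find hex, hlt.le, Nat.find_spec hex, ?_⟩
  obtain ⟨k, hk⟩ := Nat.exists_eq_succ_of_ne_zero (Nat.ne_of_gt (Nat.zero_lt_of_lt hlt))
  have hmin := Nat.find_min hex (show k < Nat.find hex by omega)
  intro h
  refine hmin ?_
  change (N : L)⁻¹ • (N : L) ^ Nat.find hex • v ∈ H at h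
  rwa [hk, smul_smul, pow_succ', inv_mul_cancel_left₀ hN0] at h

/-- Non-degeneracy provides a matrix `Z` such that `⟨Xᵀ u, Zᵀ u⟩ ≠ 1`: since `u ≠ 0`, the vector
`Zᵀ u` is arbitrary, and `Xᵀ u ≠ 0`. -/
lemma exists_polar_ne_one (hnd : IsNondegenerate f) {X : Matrix (Fin n) (Fin n) L} (hX : IsUnit X)
    {u : Fin n → L} (hu : u ≠ 0) :
    ∃ Z : Matrix (Fin n) (Fin n) L, polar f (Xᵀ *ᵥ u) (Zᵀ *ᵥ u) ≠ 1 := by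
  have hXu : Xᵀ *ᵥ u ≠ 0 := by
    intro h
    exact hu (mulVec_injective_of_isUnit ((isUnit_transpose X).2 hX) (by rw [h, mulVec_zero]))
  obtain ⟨y, hy⟩ : ∃ y, polar f y (Xᵀ *ᵥ u) ≠ 1 := by
    by_contra! h
    exact hXu (hnd.eq_zero h)
  obtain ⟨j, hj⟩ := Function.ne_iff.1 hu
  refine ⟨vecMulVec (Pi.single j (u j)⁻¹) y, ?_⟩
  have hZ : (vecMulVec (Pi.single j (u j)⁻¹) y)ᵀ *ᵥ u = y := by
    rw [transpose_vecMulVec, vecMulVec_mulVec, single_dotProduct, inv_mul_cancel₀ hj]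
    simp
  rwa [hZ, polar_comm]

/-- The inequality of `exists_polar_ne_one` persists, with the same `Z`, in a neighbourhood of
`(X, u)`, on which the multiples `N²ʳ Z` and `Nʳ Zᵀ u` are uniformly small for large `r`. -/
lemma exists_local_scale (hf : IsSecondDegreeCharacter f) (hnd : IsNondegenerate f) {N : ℕ}
    (hN : Tendsto (fun r : ℕ => (N : L) ^ r) atTop (𝓝 0))
    {X : Matrix (Fin n) (Fin n) L} (hX : IsUnit X) {u : Fin n → L} (hu : u ≠ 0)
    {U : Set (Matrix (Fin n) (Fin n) L)} (hU : U ∈ 𝓝 0) {K : Set (Fin n → L)} (hK : K ∈ 𝓝 0)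
    {S : Set (Matrix (Fin n) (Fin n) L × (Fin n → L))} :
    ∃ T ∈ 𝓝[S] (X, u), ∃ J : ℕ, ∀ p ∈ T,
      ∃ Z : Matrix (Fin n) (Fin n) L, polar f (p.1ᵀ *ᵥ p.2) (Zᵀ *ᵥ p.2) ≠ 1 ∧
        ∀ r ≥ J, (N : L) ^ (2 * r) • Z ∈ U ∧ (N : L) ^ r • Zᵀ *ᵥ p.2 ∈ K := by
  obtain ⟨Z, hZ⟩ := exists_polar_ne_one hnd hX hu
  have h1 : ∀ᶠ p in 𝓝 (X, u), polar f (p.1ᵀ *ᵥ p.2) (Zᵀ *ᵥ p.2) ≠ 1 := by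
    have hc : Continuous fun p : Matrix (Fin n) (Fin n) L × (Fin n → L) =>
        polar f (p.1ᵀ *ᵥ p.2) (Zᵀ *ᵥ p.2) := by
      have ha : Continuous fun p : Matrix (Fin n) (Fin n) L × (Fin n → L) => p.1ᵀ *ᵥ p.2 :=
        continuous_fst.matrix_transpose.matrix_mulVec continuous_snd
      have hb : Continuous fun p : Matrix (Fin n) (Fin n) L × (Fin n → L) => Zᵀ *ᵥ p.2 :=
        continuous_const.matrix_mulVec continuous_snd
      exact hf.continuous_polar_comp ha hb
    exact hc.continuousAt.eventually_ne hZ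
  have h2 : ∀ᶠ r : ℕ in atTop, (N : L) ^ (2 * r) • Z ∈ U := by
    have h2r : Tendsto (fun r : ℕ => 2 * r) atTop atTop :=
      tendsto_atTop_mono (fun r => Nat.le_mul_of_pos_left r two_pos) tendsto_id
    have h3 : Tendsto (fun r : ℕ => (N : L) ^ (2 * r)) atTop (𝓝 0) := hN.comp h2r
    have h4 : Tendsto (fun r : ℕ => (N : L) ^ (2 * r) • Z) atTop (𝓝 ((0 : L) • Z)) :=
      h3.smul tendsto_const_nhds
    rw [zero_smul] at h4
    exact h4.eventually hU
  have h3 : ∀ᶠ q : ℕ × (Fin n → L) in atTop ×ˢ 𝓝 u, (N : L) ^ q.1 • Zᵀ *ᵥ q.2 ∈ K := by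
    have hc : Continuous fun w : Fin n → L => Zᵀ *ᵥ w :=
      continuous_const.matrix_mulVec continuous_id
    have h4 : Tendsto (fun q : ℕ × (Fin n → L) => (N : L) ^ q.1 • Zᵀ *ᵥ q.2) (atTop ×ˢ 𝓝 u)
        (𝓝 ((0 : L) • Zᵀ *ᵥ u)) :=
      (hN.comp tendsto_fst).smul ((hc.tendsto u).comp tendsto_snd)
    rw [zero_smul] at h4
    exact h4.eventually hK
  obtain ⟨pa, hpa, pb, hpb, h4⟩ := eventually_prod_iff.1 h3
  obtain ⟨J, hJ⟩ := eventually_atTop.1 (h2.and hpa)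
  refine ⟨{p | polar f (p.1ᵀ *ᵥ p.2) (Zᵀ *ᵥ p.2) ≠ 1 ∧ pb p.2}, mem_nhdsWithin_of_mem_nhds
    (h1.and ((continuous_snd.tendsto (X, u)).eventually hpb)), J, fun p hp => ?_⟩
  exact ⟨Z, hp.1, fun r hr => ⟨(hJ r hr).1, h4 (hJ r hr).2 hp.2⟩⟩

/-- By compactness, the scale `J` in `exists_local_scale` can be chosen uniformly for `X` and `u` in
compact sets of invertible matrices and of nonzero vectors. -/
lemma exists_uniform_scale (hf : IsSecondDegreeCharacter f) (hnd : IsNondegenerate f) {N : ℕ}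
    (hN : Tendsto (fun r : ℕ => (N : L) ^ r) atTop (𝓝 0))
    {S : Set (Matrix (Fin n) (Fin n) L)} (hS : IsCompact S) (hSu : ∀ X ∈ S, IsUnit X)
    {Q : Set (Fin n → L)} (hQ : IsCompact Q) (hQ0 : 0 ∉ Q)
    {U : Set (Matrix (Fin n) (Fin n) L)} (hU : U ∈ 𝓝 0) {K : Set (Fin n → L)} (hK : K ∈ 𝓝 0) :
    ∃ J : ℕ, ∀ X ∈ S, ∀ u ∈ Q, ∃ Z : Matrix (Fin n) (Fin n) L,
      polar f (Xᵀ *ᵥ u) (Zᵀ *ᵥ u) ≠ 1 ∧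
        ∀ r ≥ J, (N : L) ^ (2 * r) • Z ∈ U ∧ (N : L) ^ r • Zᵀ *ᵥ u ∈ K := by
  suffices h : ∃ J : ℕ, ∀ p ∈ S ×ˢ Q, ∃ Z : Matrix (Fin n) (Fin n) L,
      polar f (p.1ᵀ *ᵥ p.2) (Zᵀ *ᵥ p.2) ≠ 1 ∧
        ∀ r ≥ J, (N : L) ^ (2 * r) • Z ∈ U ∧ (N : L) ^ r • Zᵀ *ᵥ p.2 ∈ K by
    obtain ⟨J, hJ⟩ := h
    exact ⟨J, fun X hX u hu => hJ (X, u) ⟨hX, hu⟩⟩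
  refine (hS.prod hQ).induction_on (p := fun T => ∃ J : ℕ, ∀ p ∈ T,
    ∃ Z : Matrix (Fin n) (Fin n) L, polar f (p.1ᵀ *ᵥ p.2) (Zᵀ *ᵥ p.2) ≠ 1 ∧
        ∀ r ≥ J, (N : L) ^ (2 * r) • Z ∈ U ∧ (N : L) ^ r • Zᵀ *ᵥ p.2 ∈ K) ?_ ?_ ?_ ?_
  · exact ⟨0, by simp⟩
  · rintro T T' hTT' ⟨J, hJ⟩
    exact ⟨J, fun p hp => hJ p (hTT' hp)⟩
  · rintro T T' ⟨J, hJ⟩ ⟨J', hJ'⟩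
    refine ⟨max J J', ?_⟩
    rintro p (hp | hp)
    · obtain ⟨Z, hZ, hZ'⟩ := hJ p hp
      exact ⟨Z, hZ, fun r hr => hZ' r (le_of_max_le_left hr)⟩
    · obtain ⟨Z, hZ, hZ'⟩ := hJ' p hp
      exact ⟨Z, hZ, fun r hr => hZ' r (le_of_max_le_right hr)⟩
  · rintro ⟨X, u⟩ ⟨hX, hu⟩
    exact exists_local_scale hf hnd hN (hSu X hX) (fun h => hQ0 (h ▸ hu)) hU hK

/-- The non-archimedean case. For large `v` and fixed `X`, the function `f (Xᵀ v)` is multiplied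
by a nontrivial character when `X` is translated by a suitable compact open group of matrices under
which the amplitude is invariant, so the integral vanishes. -/
theorem isSchwartzBruhat_lam_of_isLocallyConstant [CharZero L] (hL : ¬ DiscreteTopology L)
    [MeasurableSpace (GL (Fin n) L)] [BorelSpace (GL (Fin n) L)]
    (μ : Measure (GL (Fin n) L)) [μ.IsHaarMeasure]
    (hf : IsSecondDegreeCharacter f) (hnd : IsNondegenerate f)
    {φ : GL (Fin n) L → ℂ} (hφ' : HasCompactSupport φ) (hφ : IsLocallyConstant φ) :
    IsSchwartzBruhat (lam μ φ f) := by
  borelize (Matrix (Fin n) (Fin n) L)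
  let ν : Measure (Matrix (Fin n) (Fin n) L) := Measure.addHaar
  have hδ : IsLocallyConstant (modulus : GL (Fin n) L →* ℝ≥0) := isLocallyConstant_modulus
  obtain ⟨c, hc⟩ := exists_lam_eq ν modulus hδ.continuous
    (fun g => addEquivAddHaarChar_smul_map ν (mulLeftEquiv g)) μ hf.continuous hφ.continuous hφ'
  set ψ := matrixAmplitude modulus φ with hψdef
  obtain ⟨S, hS, hSu, hS0⟩ := exists_isCompact_matrixAmplitude modulus hφ'
  obtain ⟨G, hGo, hGc, hG⟩ := exists_addSubgroup_matrixAmplitude_add hδ hφ hφ'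
  rw [← hψdef] at hS0 hG
  have hψc : Continuous ψ := by
    refine IsLocallyConstant.continuous ((IsLocallyConstant.iff_eventually_eq _).2 fun X => ?_)
    have h1 : Tendsto (fun X' => X' - X) (𝓝 X) (𝓝 0) :=
      (continuous_sub_right X).tendsto' _ _ (sub_self X)
    filter_upwards [h1.eventually (hGo.mem_nhds G.zero_mem)] with X' hX'
    simpa using hG X _ hX'
  refine Or.inr ⟨inferInstance, (IsLocallyConstant.iff_eventually_eq _).2 fun v => ?_, ?_⟩
  · have h1 : ∀ᶠ v' in 𝓝 v, ∀ X ∈ S, f (Xᵀ *ᵥ v') = f (Xᵀ *ᵥ v) := by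
      refine hS.eventually_forall_of_forall_eventually
        (P := fun v' X => f (Xᵀ *ᵥ v') = f (Xᵀ *ᵥ v)) fun X _ => ?_
      have h2 : Continuous fun p : (Fin n → L) × Matrix (Fin n) (Fin n) L => p.2ᵀ *ᵥ p.1 :=
        continuous_snd.matrix_transpose.matrix_mulVec continuous_fst
      have h3 : Continuous fun p : (Fin n → L) × Matrix (Fin n) (Fin n) L => p.2ᵀ *ᵥ v :=
        continuous_snd.matrix_transpose.matrix_mulVec continuous_const
      filter_upwards [(h2.tendsto (v, X)).eventually (hf.eventually_eq _),
        (h3.tendsto (v, X)).eventually (hf.eventually_eq _)] with p hp hp'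
      rw [hp, hp']
    filter_upwards [h1] with v' hv'
    rw [hc, hc]
    congr 1
    refine integral_congr_ae (.of_forall fun X => ?_)
    by_cases hX : X ∈ S
    · simp only [hv' X hX]
    · simp only [hS0 X hX, zero_mul]
  · obtain ⟨N, hN0, hN⟩ := exists_nat_tendsto_pow_zero hL
    obtain ⟨K, hKo, hK⟩ := hf.exists_addSubgroup_eq_one
    obtain ⟨Q, hQ, hQ0, hQv⟩ := exists_compact_fundamental_domain (n := n) hN0 hN
    obtain ⟨J, hJ⟩ := exists_uniform_scale hf hnd hN hS hSu hQ hQ0 (hGo.mem_nhds G.zero_mem)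
      (hKo.mem_nhds K.zero_mem)
    obtain ⟨C, hC, hCv⟩ := hQv J
    refine HasCompactSupport.intro hC fun v hv => ?_
    obtain ⟨r, hrJ, hr⟩ := hCv v hv
    have hac : Continuous fun Y : Matrix (Fin n) (Fin n) L => Yᵀ *ᵥ v :=
      continuous_id.matrix_transpose.matrix_mulVec continuous_const
    let T : Matrix (Fin n) (Fin n) L →+ (Fin n → L) :=
      AddMonoidHom.mk' (fun Y => Yᵀ *ᵥ v) fun Y Y' => by rw [transpose_add, add_mulVec]
    let G' : AddSubgroup (Matrix (Fin n) (Fin n) L) := G ⊓ K.comap T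
    have hG'o : IsOpen (G' : Set (Matrix (Fin n) (Fin n) L)) := hGo.inter (hKo.preimage hac)
    have hG'c : IsCompact (G' : Set (Matrix (Fin n) (Fin n) L)) :=
      hGc.of_isClosed_subset (G'.isClosed_of_isOpen hG'o) Set.inter_subset_left
    rw [hc, integral_eq_zero_of_character ν (G := G') _ _ hG'o hG'c
      (fun X Y => polar f (Xᵀ *ᵥ v) (Yᵀ *ᵥ v)), mul_zero]
    · intro X Y Y'
      rw [transpose_add, add_mulVec, hf.polar_add_right]
    · rintro X Y ⟨hY, hY'⟩
      have hY1 : f (Yᵀ *ᵥ v) = 1 := hK _ hY'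
      rw [hG X Y hY, transpose_add, add_mulVec, map_add_eq f (Xᵀ *ᵥ v), hY1, mul_one,
        Circle.coe_mul, mul_assoc]
    · intro X hX
      have hXS : X ∈ S := by
        by_contra h
        simp [hS0 X h] at hX
      obtain ⟨Z, hZ, hZ'⟩ := hJ X hXS _ hr
      obtain ⟨h1, h2⟩ := hZ' r hrJ
      -- Of the factor `N²ʳ`, one `Nʳ` moves `v` into `Q`, the other one moves `Xᵀ v` there.
      have hYv : ((N : L) ^ (2 * r) • Z)ᵀ *ᵥ v = (N : L) ^ r • Zᵀ *ᵥ (N : L) ^ r • v := by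
        rw [transpose_smul, smul_mulVec, mulVec_smul, smul_smul, two_mul, pow_add]
      refine ⟨(N : L) ^ (2 * r) • Z, ⟨h1, ?_⟩, ?_⟩
      · change ((N : L) ^ (2 * r) • Z)ᵀ *ᵥ v ∈ K
        rw [hYv]
        exact h2
      · rw [hYv, ← Nat.cast_pow, Nat.cast_smul_eq_nsmul, Nat.cast_smul_eq_nsmul,
          ← hf.polar_nsmul_comm]
        rwa [mulVec_smul, ← Nat.cast_pow, Nat.cast_smul_eq_nsmul, Nat.cast_smul_eq_nsmul] at hZ
    · exact hψc.mul (continuous_circle_coe.comp (hf.continuous.comp hac))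
    · exact (HasCompactSupport.intro hS hS0).mul_right

end Nonarchimedean

end SecondDegree

end

theorem mainTheorem9
    {L : Type*} [Field L] [CharZero L] [TopologicalSpace L] [IsTopologicalDivisionRing L]
    [T2Space L] [LocallyCompactSpace L] (hL : ¬ DiscreteTopology L)
    (n : ℕ)
    [MeasurableSpace (GL (Fin n) L)] [BorelSpace (GL (Fin n) L)]
    (μ : MeasureTheory.Measure (GL (Fin n) L)) [μ.IsHaarMeasure]
    (f : (Fin n → L) → Circle)
    (hf : SecondDegree.IsSecondDegreeCharacter f) (hnd : SecondDegree.IsNondegenerate f)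
    (φ : GL (Fin n) L → ℂ) (hφ : SecondDegree.IsTestFunctionGL φ) :
    (∀ v : Fin n → L, MeasureTheory.Integrable (SecondDegree.integrand φ f v) μ) ∧
      SecondDegree.IsSchwartzBruhat (SecondDegree.lam μ φ f) := by
  have hφc : Continuous φ := by
    rcases hφ.1 with ⟨m, e, he⟩ | ⟨-, hloc⟩
    · exact SecondDegree.continuous_of_contDiffOn e he
    · exact hloc.continuous
  refine ⟨fun v => SecondDegree.integrable_integrand μ hf.continuous hφc hφ.2 v, ?_⟩
  rcases hφ.1 with ⟨m, e, he⟩ | ⟨hTD, hloc⟩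
  · exact SecondDegree.isSchwartzBruhat_lam_of_contDiffOn e μ hf hnd hφ.2 he
  · exact SecondDegree.isSchwartzBruhat_lam_of_isLocallyConstant hL μ hf hnd hφ.2 hloc
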